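/- Throughout, an algorithm is QPT (quantum polynomial time) if it is a uniform quantum algorithm whose running time is bounded by a polynomial in the total length of its inputs; every algorithm, honest or adversarial, is given the security parameter $1^\lambda$. A two-tier tokenized signature scheme (2-TS) is a tuple $(\mathsf{TS.KeyGen},\mathsf{TS.StateGen},\mathsf{TS.Sign},\mathsf{TS.Ver}_0,\mathsf{TS.Ver}_1)$ of QPT algorithms: $\mathsf{KeyGen}(1^\lambda)\to(sk,pk)$ (classical keys), $\mathsf{StateGen}(sk)\to\psi$ (a quantum state), $\mathsf{Sign}(\psi,b)\to\sigma$ (classical, for $b\in\{0,1\}$), $\mathsf{Ver}_0(pk,\sigma)\to\top/\bot$, $\mathsf{Ver}_1(sk,\sigma)\to\top/\bot$, such that (correctness) for $(sk,pk)\gets\mathsf{KeyGen}(1^\lambda)$, $\psi\gets\mathsf{StateGen}(sk)$, $\mathsf{Ver}_0(pk,\mathsf{Sign}(\psi,0))$ accepts with probability at least $1-\mathrm{negl}(\lambda)$, and so does $\mathsf{Ver}_1(sk,\mathsf{Sign}(\psi,1))$; and (security) for every QPT adversary $\mathcal B$, the probability $\mathrm{Adv}^{\mathsf{TS}}_{\mathcal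 B}(\lambda)$ that $(\sigma_0,\sigma_1)\gets\mathcal B(\psi,pk)$ satisfies both $\mathsf{Ver}_0(pk,\sigma_0)=\top$ and $\mathsf{Ver}_1(sk,\sigma_1)=\top$ is negligible. A digital signature scheme with revocable (quantum) signatures for the message space $\{0,1\}^k$, with no-query deletion security, is a tuple of QPT algorithms $\mathsf{KeyGen}(1^\lambda)\to(sigk,vk)$, $\mathsf{Sign}(sigk,m)\to(\psi,ck)$ ($\psi$ quantum, $ck$ classical), $\mathsf{Ver}(vk,\psi,m)\to\top/\bot$, $\mathsf{Del}(\psi)\to cert$ (classical), $\mathsf{Cert}(ck,cert)\to\top/\bot$, such that for each $m\in\{0,1\}^k$, with $(sigk,vk)\gets\mathsf{KeyGen}(1^\lambda)$ and $(\psi,ck)\gets\mathsf{Sign}(sigk,m)$: $\mathsf{Ver}(vk,\psi,m)$ accepts with probability at least $1-\mathrm{negl}(\lambda)$ (correctness), and $\mathsf{Cert}(ck,\mathsf{Del}(\psi))$ accepts with probability at least $1-\mathrm{negl}(\lambda)$ (deletion correctness); and (no-query deletion security) for every pair $\mathcal A=(\mathcal A_1,\mathcal A_2)$ of QPT algorithms,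 $$\mathrm{Adv}^{\mathsf{Del}}_{\mathcal A}(\lambda)=\Pr\left[\mathsf{Cert}(ck^*,cert)=\top\wedge\mathsf{Ver}(vk,\psi,m^*)=\top:\begin{array}{l}(sigk,vk)\gets\mathsf{KeyGen}(1^\lambda)\\(m^*,\mathsf{st})\gets\mathcal A_1(vk)\\(\psi^*,ck^*)\gets\mathsf{Sign}(sigk,m^*)\\(cert,\psi)\gets\mathcal A_2(\mathsf{st},\psi^*)\end{array}\right]\le\mathrm{negl}(\lambda),$$ where $\mathsf{st}$ may be quantum and $\mathcal A$ wins only if $m^*\in\{0,1\}^k$. Theorem. Let $\mathsf{TS}$ be a two-tier tokenized signature scheme, and let $k$ be a fixed length. Then there is a digital signature scheme with revocable signatures for the message space $\{0,1\}^k$ that satisfies correctness, deletion correctness and no-query deletion security, and has the following form. $\mathsf{KeyGen}$ generates $2^k$ independent key pairs $(sk_m,pk_m)\gets\mathsf{TS.KeyGen}(1^\lambda)$, $m\in\{0,1\}^k$, with $sigk=(sk_m)_m$ and $vk=(pk_m)_m$. $\mathsf{Sign}(sigk,m)$ outputs a token $\psi\gets\mathsf{TS.StateGen}(sk_m)$ and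 the check key $ck=sk_m$. $\mathsf{Ver}(vk,\psi,m)$ runs $\sigma\gets\mathsf{TS.Sign}(\psi,0)$ and outputs $\mathsf{TS.Ver}_0(pk_m,\sigma)$. $\mathsf{Del}(\psi)$ outputs $\mathsf{TS.Sign}(\psi,1)$. $\mathsf{Cert}(ck,cert)$ outputs $\mathsf{TS.Ver}_1(ck,cert)$. Moreover, for every pair $\mathcal A=(\mathcal A_1,\mathcal A_2)$ of QPT algorithms there is a QPT algorithm $\mathcal B$ with $$\mathrm{Adv}^{\mathsf{TS}}_{\mathcal B}(\lambda)\ge 2^{-k}\,\mathrm{Adv}^{\mathsf{Del}}_{\mathcal A}(\lambda)\qquad\text{for all }\lambda;$$ in particular the factor is $\tfrac12$ for single-bit messages ($k=1$). -/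

import Mathlib

open scoped NNReal ENNReal

noncomputable section

namespace QCrypto

/-! ## Classical data

Classical values are finite binary trees. The bits are `nil` and `cons nil nil`, a bit string
is the right-leaning list of its bits, numbers are written in unary, and a pair is a `cons`. -/

inductive Data : Type
  | nil : Data
  | cons : Data → Data → Data

namespace Data

/-- Number of nodes. -/
def size : Data → ℕ
  | nil => 1
  | cons a b => a.size + b.size + 1

/-- Length as a list; also the number represented in unary. -/
def length : Data → ℕ
  | nil => 0
  | cons _ b => b.length + 1

def fst : Data → Data
  | nil => nil
  | cons a _ => a

def snd : Data → Data
  | nil => nil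
  | cons _ b => b

def isNil : Data → Bool
  | nil => true
  | cons _ _ => false

/-- Reading of a verdict: every tree but `nil` means "accept". -/
def accepts (d : Data) : Bool := !d.isNil

def ofBool : Bool → Data
  | false => nil
  | true => cons nil nil

def ofBits : List Bool → Data
  | [] => nil
  | b :: l => cons (ofBool b) (ofBits l)

def unary : ℕ → Data
  | 0 => nil
  | n + 1 => cons nil (unary n)

end Data

/-! ## Quantum memory

The quantum memory consists of tapes `0, 1, 2, …`, each with qubits `0, 1, 2, …`; the pair `(r, i)`
is qubit `i` of tape `r`. All but finitely many qubits are in the state `|0⟩`, so a computational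
basis state is the finite set of the qubits that are `1`. A pure state is a nonzero vector, taken up
to a scalar factor: amplitudes need not be normalised, and probabilities are ratios of squared
norms. -/

abbrev Cell : Type := ℕ × ℕ

abbrev QState : Type := Finset Cell →₀ ℂ

/-- The state in which every qubit is `|0⟩`. -/
def blank : QState := Finsupp.single ∅ 1

/-- The squared norm. -/
def sqNorm (v : QState) : ℝ≥0 := v.sum fun _ a => ‖a‖₊ ^ 2

/-- The number of qubits that a tape must have to hold the state (on each of its tapes). -/
def qlen (v : QState) : ℕ := v.support.sup fun s => s.sup fun c => c.2 + 1

/-- The basis state `s` with qubit `c` set to `b`. -/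
def setBit (s : Finset Cell) (c : Cell) (b : Bool) : Finset Cell :=
  if b then insert c s else s.erase c

/-- The single-qubit gate with matrix `U`, on qubit `c`. -/
def applyGate (U : Matrix Bool Bool ℂ) (c : Cell) (v : QState) : QState :=
  v.sum fun s a => ∑ b : Bool, Finsupp.single (setBit s c b) (U b (decide (c ∈ s)) * a)

/-- The Hadamard gate. -/
def gateH : Matrix Bool Bool ℂ :=
  Matrix.of fun b b' => (if b && b' then -1 else 1) / (Real.sqrt 2 : ℂ)

/-- The `π/8` gate, `diag(1, exp(iπ/4))`. -/
def gateT : Matrix Bool Bool ℂ :=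
  Matrix.diagonal fun b => if b then Complex.exp (Complex.I * Real.pi / 4) else 1

/-- The controlled NOT with control `c` and target `d`; nothing happens if they coincide. -/
def applyCNOT (c d : Cell) (v : QState) : QState :=
  if c = d then v
  else v.mapDomain fun s => if c ∈ s then setBit s d (decide (d ∉ s)) else s

/-- The (unnormalised) state after outcome `b` in the measurement of qubit `c` in the
computational basis. -/
def project (c : Cell) (b : Bool) (v : QState) : QState :=
  v.filter fun s => decide (c ∈ s) = b

lemma sqNorm_project_le (c : Cell) (b : Bool) (v : QState) :
    sqNorm (project c b v) ≤ sqNorm v := by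
  unfold sqNorm project Finsupp.sum
  refine le_trans (le_of_eq (Finset.sum_congr rfl ?_))
    (Finset.sum_le_sum_of_subset (f := fun s => ‖v s‖₊ ^ 2) ?_)
  · intro s hs
    rw [Finsupp.support_filter, Finset.mem_filter] at hs
    simp [hs.2]
  · rw [Finsupp.support_filter]
    exact Finset.filter_subset _ _

/-- The probability of outcome `1` in the measurement of qubit `c`. -/
def probOne (c : Cell) (v : QState) : ℝ≥0 := sqNorm (project c true v) / sqNorm v

lemma probOne_le_one (c : Cell) (v : QState) : probOne c v ≤ 1 :=
  div_le_one_of_le₀ (sqNorm_project_le c true v) zero_le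

/-- The outcome of the measurement of qubit `c`. -/
def outcome (c : Cell) (v : QState) : PMF Bool :=
  PMF.ofFintype (fun b => if b then (probOne c v : ℝ≥0∞) else 1 - (probOne c v : ℝ≥0∞)) (by
    have h : (probOne c v : ℝ≥0∞) ≤ 1 := by exact_mod_cast probOne_le_one c v
    simpa using add_tsub_cancel_of_le h)

/-- The product state `ψ ⊗ φ`, with tape `r` of `ψ` placed on tape `3 r`, tape `r` of `φ` placed
on tape `3 r + 1`, and the tapes `3 r + 2` blank. -/
def tensor (ψ φ : QState) : QState :=
  ψ.sum fun s a => φ.sum fun t b =>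
    Finsupp.single (s.image (fun c => (3 * c.1, c.2)) ∪ t.image (fun c => (3 * c.1 + 1, c.2)))
      (a * b)

/-! ## Quantum programs

A machine has classical registers `0, 1, 2, …`, each holding a tree, and the quantum memory. Programs
are built from elementary instructions by sequencing, branching and unbounded loops, under
classical control. Qubits are addressed by a tape name, fixed in the program, and by a position, the
length of the content of a register. -/

inductive Instr : Type
  /-- `x := nil` -/
  | clear (x : ℕ)
  /-- `x := y` -/
  | copy (x y : ℕ)
  /-- `x := cons y z` -/
  | cons (x y z : ℕ)
  /-- `x := fst y` -/
  | fst (x y : ℕ)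
  /-- `x := snd y` -/
  | snd (x y : ℕ)
  /-- Hadamard gate on qubit `(r, length x)` -/
  | had (r x : ℕ)
  /-- `π/8` gate on qubit `(r, length x)` -/
  | phase (r x : ℕ)
  /-- controlled NOT, control `(r, length x)`, target `(s, length y)` -/
  | cnot (r x s y : ℕ)
  /-- measure qubit `(r, length x)` and store the outcome in `z` -/
  | meas (r x z : ℕ)

inductive Prog : Type
  | skip : Prog
  | instr : Instr → Prog
  | seq : Prog → Prog → Prog
  /-- the first program if register `x` is not `nil`, otherwise the second one -/
  | ite (x : ℕ) : Prog → Prog → Prog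
  /-- repeat as long as register `x` is not `nil` -/
  | loop (x : ℕ) : Prog → Prog

abbrev Regs : Type := ℕ → Data

/-- The time that an instruction takes: one unit, and one for each node of its operands. -/
def Instr.cost (g : Regs) : Instr → ℕ
  | clear _ => 1
  | copy _ y => 1 + (g y).size
  | cons _ y z => 1 + (g y).size + (g z).size
  | fst _ y => 1 + (g y).size
  | snd _ y => 1 + (g y).size
  | had _ x => 1 + (g x).size
  | phase _ x => 1 + (g x).size
  | cnot _ x _ y => 1 + (g x).size + (g y).size
  | meas _ x _ => 1 + (g x).size

/-- The effect of an instruction on registers and quantum memory. -/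
def Instr.exec (g : Regs) (v : QState) : Instr → PMF (Regs × QState)
  | clear x => PMF.pure (Function.update g x Data.nil, v)
  | copy x y => PMF.pure (Function.update g x (g y), v)
  | cons x y z => PMF.pure (Function.update g x (Data.cons (g y) (g z)), v)
  | fst x y => PMF.pure (Function.update g x (g y).fst, v)
  | snd x y => PMF.pure (Function.update g x (g y).snd, v)
  | had r x => PMF.pure (g, applyGate gateH (r, (g x).length) v)
  | phase r x => PMF.pure (g, applyGate gateT (r, (g x).length) v)
  | cnot r x s y => PMF.pure (g, applyCNOT (r, (g x).length) (s, (g y).length) v)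
  | meas r x z => (outcome (r, (g x).length) v).map fun b =>
      (Function.update g z (Data.ofBool b), project (r, (g x).length) b v)

/-- A configuration: the programs still to be executed, in this order, the classical registers, the
quantum memory and the time spent so far. -/
structure Config : Type where
  todo : List Prog
  regs : Regs
  mem : QState
  clock : ℕ

/-- One step of the execution; a configuration with nothing left to do has halted. -/
def step (c : Config) : PMF Config :=
  match c.todo with
  | [] => PMF.pure c
  | Prog.skip :: k => PMF.pure { c with todo := k, clock := c.clock + 1 }
  | Prog.instr o :: k => (o.exec c.regs c.mem).map fun s =>
      { todo := k, regs := s.1, mem := s.2, clock := c.clock + o.cost c.regs }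
  | Prog.seq P Q :: k => PMF.pure { c with todo := P :: Q :: k, clock := c.clock + 1 }
  | Prog.ite x P Q :: k => PMF.pure
      { c with todo := (if (c.regs x).isNil then Q else P) :: k, clock := c.clock + 1 }
  | Prog.loop x P :: k => PMF.pure
      { c with
        todo := if (c.regs x).isNil then k else P :: Prog.loop x P :: k
        clock := c.clock + 1 }

/-- The configuration after `T` steps. -/
def steps : ℕ → Config → PMF Config
  | 0, c => PMF.pure c
  | T + 1, c => (step c).bind (steps T)

/-- The initial configuration, with security parameter `n` (given in unary), classical input `x` and
quantum inputs `ψ`, `φ`. -/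
def initial (P : Prog) (n : ℕ) (x : Data) (ψ φ : QState) : Config where
  todo := [P]
  regs := fun i => if i = 0 then Data.unary n else if i = 1 then x else Data.nil
  mem := tensor ψ φ
  clock := 0

/-- The total length of the inputs. -/
def inputLength (n : ℕ) (x : Data) (ψ φ : QState) : ℕ := n + x.size + qlen ψ + qlen φ

/-- A quantum polynomial-time algorithm with `q` quantum inputs (`q = 0, 1, 2`; the missing ones
are blank): a program that halts, with certainty and on all inputs, within a time that is
polynomial in the length of its inputs. -/
structure QPT (q : ℕ) : Type where
  prog : Prog
  time : Polynomial ℕ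
  halts : ∀ (n : ℕ) (x : Data) (ψ φ : QState), ψ ≠ 0 → φ ≠ 0 →
    (q < 1 → ψ = blank) → (q < 2 → φ = blank) →
    ∀ c ∈ (steps (time.eval (inputLength n x ψ φ)) (initial prog n x ψ φ)).support,
      c.todo = [] ∧ c.clock ≤ time.eval (inputLength n x ψ φ)

/-- The output of an algorithm: the content of register `0`, and the state of the whole quantum
memory. (What the algorithm does not want to hand over it can measure and reset; an algorithm with
classical output only has its quantum output ignored.) -/
def QPT.run {q : ℕ} (A : QPT q) (n : ℕ) (x : Data) (ψ φ : QState) : PMF (Data × QState) :=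
  (steps (A.time.eval (inputLength n x ψ φ)) (initial A.prog n x ψ φ)).map
    fun c => (c.regs 0, c.mem)

/-! ## Negligible functions -/

def Negligible (f : ℕ → ℝ) : Prop :=
  Asymptotics.SuperpolynomialDecay Filter.atTop (fun n : ℕ => (n : ℝ)) f

/-- The probability that an experiment succeeds. -/
def prob (E : PMF Bool) : ℝ := (E true).toReal

/-! ## Two-tier tokenized signatures -/

structure TwoTier : Type where
  keyGen : QPT 0
  stateGen : QPT 0
  sign : QPT 1
  ver₀ : QPT 0
  ver₁ : QPT 0

namespace TwoTier

variable (S : TwoTier) (n : ℕ)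

/-- The pair `(sk, pk)`. -/
def KeyGen : PMF (Data × Data) :=
  (S.keyGen.run n Data.nil blank blank).map fun o => (o.1.fst, o.1.snd)

def StateGen (sk : Data) : PMF QState := (S.stateGen.run n sk blank blank).map Prod.snd

def Sign (ψ : QState) (m : Bool) : PMF Data := (S.sign.run n (Data.ofBool m) ψ blank).map Prod.fst

def Ver₀ (pk σ : Data) : PMF Bool :=
  (S.ver₀.run n (Data.cons pk σ) blank blank).map fun o => o.1.accepts

def Ver₁ (sk σ : Data) : PMF Bool :=
  (S.ver₁.run n (Data.cons sk σ) blank blank).map fun o => o.1.accepts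

def correctGame₀ : PMF Bool := do
  let (sk, pk) ← S.KeyGen n
  let ψ ← S.StateGen n sk
  let σ ← S.Sign n ψ false
  S.Ver₀ n pk σ

def correctGame₁ : PMF Bool := do
  let (sk, _) ← S.KeyGen n
  let ψ ← S.StateGen n sk
  let σ ← S.Sign n ψ true
  S.Ver₁ n sk σ

/-- The adversary gets the token and the public key, and outputs the pair `(σ₀, σ₁)`. -/
def forgeGame (A : QPT 1) : PMF Bool := do
  let (sk, pk) ← S.KeyGen n
  let ψ ← S.StateGen n sk
  let (σ, _) ← A.run n pk ψ blank
  let b₀ ← S.Ver₀ n pk σ.fst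
  let b₁ ← S.Ver₁ n sk σ.snd
  pure (b₀ && b₁)

def Correct : Prop :=
  Negligible (fun n => 1 - prob (S.correctGame₀ n)) ∧
  Negligible (fun n => 1 - prob (S.correctGame₁ n))

def Secure : Prop := ∀ A : QPT 1, Negligible fun n => prob (S.forgeGame n A)

end TwoTier

/-! ## Digital signatures with revocable signatures -/

structure Revocable : Type where
  keyGen : QPT 0
  sign : QPT 0
  ver : QPT 1
  del : QPT 1
  cert : QPT 0

namespace Revocable

variable (R : Revocable) (n : ℕ)

/-- The pair `(sigk, vk)`. -/
def KeyGen : PMF (Data × Data) :=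
  (R.keyGen.run n Data.nil blank blank).map fun o => (o.1.fst, o.1.snd)

/-- The pair `(ψ, ck)`. -/
def Sign (sigk m : Data) : PMF (QState × Data) :=
  (R.sign.run n (Data.cons sigk m) blank blank).map fun o => (o.2, o.1)

def Ver (vk : Data) (ψ : QState) (m : Data) : PMF Bool :=
  (R.ver.run n (Data.cons vk m) ψ blank).map fun o => o.1.accepts

def Del (ψ : QState) : PMF Data := (R.del.run n Data.nil ψ blank).map Prod.fst

def Cert (ck c : Data) : PMF Bool :=
  (R.cert.run n (Data.cons ck c) blank blank).map fun o => o.1.accepts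

def correctGame (m : Data) : PMF Bool := do
  let (sigk, vk) ← R.KeyGen n
  let (ψ, _) ← R.Sign n sigk m
  R.Ver n vk ψ m

def deletionGame (m : Data) : PMF Bool := do
  let (sigk, _) ← R.KeyGen n
  let (ψ, ck) ← R.Sign n sigk m
  let c ← R.Del n ψ
  R.Cert n ck c

/-- An adversary against no-query deletion security. -/
structure Adversary : Type where
  fst : QPT 0
  snd : QPT 2

open Classical in
/-- The first algorithm gets the verification key and outputs a message and a state, which has a
classical part `s` and a quantum part `st`; the second one gets that state and the signature, and
outputs a certificate `c` and a quantum state `ψ'`. Messages are the bit strings of length `k`, and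
the adversary loses if its message is not one. -/
def revokeGame (k : ℕ) (A : Adversary) : PMF Bool := do
  let (sigk, vk) ← R.KeyGen n
  let (o, st) ← A.fst.run n vk blank blank
  let m := o.fst
  let s := o.snd
  let (ψ, ck) ← R.Sign n sigk m
  let (c, ψ') ← A.snd.run n s st ψ
  let b ← R.Cert n ck c
  let b' ← R.Ver n vk ψ' m
  pure (decide (∃ l : List Bool, l.length = k ∧ m = Data.ofBits l) && (b && b'))

/-- Correctness for the message space `{0,1}^k`. -/
def Correct (k : ℕ) : Prop := ∀ l : List Bool, l.length = k →
  Negligible fun n => 1 - prob (R.correctGame n (Data.ofBits l))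

/-- Deletion correctness for the message space `{0,1}^k`. -/
def DeletionCorrect (k : ℕ) : Prop := ∀ l : List Bool, l.length = k →
  Negligible fun n => 1 - prob (R.deletionGame n (Data.ofBits l))

/-- No-query deletion security for the message space `{0,1}^k`. -/
def NoQueryDeletionSecure (k : ℕ) : Prop :=
  ∀ A : Adversary, Negligible fun n => prob (R.revokeGame n k A)

end Revocable

/-! ## Signing with a token -/

/-- The component at position `l` of a complete binary tree, whose depth is the length of `l`. -/
def select : List Bool → Data → Data
  | [], d => d
  | b :: l, d => select l (if b then d.snd else d.fst)

/-- Independent key pairs, one for each bit string of length `k`; the secret keys are collected in a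
complete binary tree of depth `k`, and so are the public keys. For `k = 1` the result is
`((sk₀, sk₁), (pk₀, pk₁))`. -/
def keyTrees (S : TwoTier) (n : ℕ) : ℕ → PMF (Data × Data)
  | 0 => S.KeyGen n
  | k + 1 => do
      let (sk, pk) ← keyTrees S n k
      let (sk', pk') ← keyTrees S n k
      pure (Data.cons sk sk', Data.cons pk pk')

/-- The scheme `R` has a key pair of `S` for each message in `{0,1}^k`; a signature on `m` is a
token under key pair `m`, with the secret key as check key; verification signs `0` with the token
and checks the result under public key `m`; deletion signs `1`, and a certificate is checked
under the secret key. -/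
structure SignsWithTokens (R : Revocable) (S : TwoTier) (k : ℕ) : Prop where
  keyGen : ∀ n, R.KeyGen n = keyTrees S n k
  sign : ∀ (n : ℕ) (sigk : Data) (l : List Bool), l.length = k →
    R.Sign n sigk (Data.ofBits l) =
      (S.StateGen n (select l sigk)).map fun ψ => (ψ, select l sigk)
  ver : ∀ (n : ℕ) (vk : Data) (ψ : QState) (l : List Bool), ψ ≠ 0 → l.length = k →
    R.Ver n vk ψ (Data.ofBits l) = do
      let σ ← S.Sign n ψ false
      S.Ver₀ n (select l vk) σ
  del : ∀ (n : ℕ) (ψ : QState), ψ ≠ 0 → R.Del n ψ = S.Sign n ψ true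
  cert : ∀ (n : ℕ) (ck c : Data), R.Cert n ck c = S.Ver₁ n ck c

end QCrypto

end

noncomputable section

namespace QCrypto

/-! ## Amplitudes after the elementary operations -/

/-! Correctness is inherited from the token scheme. The key pair at a fixed position of a tree of
independent key pairs is distributed as a fresh key pair, so for a fixed message the two correctness
experiments of the signature scheme are, as distributions, those of the token scheme
(`correctGame_eq`, `deletionGame_eq`).

For security, the forger is given one token and its public key. It draws a uniform position `l`,
plants the public key there in a tree of keys that it generates itself, and runs `A₁` on that tree.
It runs `A₂` on the resulting state and the token, then signs `0` with the quantum state that `A₂`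
returns, and outputs this signature with the certificate. The planted tree is distributed as an
honest one and is independent of `l` (`keyGen_bind_plant`), so the message chosen by `A₁` equals `l`
with probability `2^(-k)`, whatever `A₁` does. For that value of `l`, the rest of the forgery
experiment is the rest of the deletion experiment, since `Ver` and `Cert` are the two verifications
of the token scheme. The other values of `l` can only help the forger, so an inequality results
(`mul_revokeGame_le`).

Most of the work is to show that the algorithms involved are QPT in the concrete machine model. A
subroutine runs on renamed registers and tapes, where it behaves as it does alone, while the other
memory is an untouched tensor factor (`split`, `steps_lift`). Programs are composed in a relational
logic: `Realizes` couples final configurations with the result of an abstract experiment, and `Spec`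
adds a time bound polynomial in the size of the memory. The time spent bounds the growth of the
memory (`small_of_mem_steps`), so these bounds compose (`Spec.seq`). As `k` is fixed, the number of
subroutine calls is constant. `spec_call` and `Spec.exists_qpt` translate between algorithms and
specifications. -/

lemma mem_setBit {s : Finset Cell} {c d : Cell} {b : Bool} :
    d ∈ setBit s c b ↔ if d = c then b = true else d ∈ s := by
  unfold setBit
  cases b <;> by_cases h : d = c <;> simp [h]

lemma setBit_setBit (s : Finset Cell) (c : Cell) (b b' : Bool) :
    setBit (setBit s c b) c b' = setBit s c b' := by
  ext d
  simp only [mem_setBit]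
  split_ifs <;> simp_all

lemma setBit_self (s : Finset Cell) (c : Cell) : setBit s c (decide (c ∈ s)) = s := by
  ext d
  simp only [mem_setBit]
  split_ifs with h <;> simp_all

lemma setBit_eq_iff {s u : Finset Cell} {c : Cell} {b : Bool} :
    setBit s c b = u ↔ b = decide (c ∈ u) ∧ s = setBit u c (decide (c ∈ s)) := by
  constructor
  · rintro rfl
    refine ⟨?_, ?_⟩
    · simp [mem_setBit]
    · rw [setBit_setBit, setBit_self]
  · rintro ⟨h, h'⟩
    rw [h, h', setBit_setBit, setBit_self]

/-- This turns the sum over source states into a formula for each amplitude. Later facts about gates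
can then be checked coordinate by coordinate. -/
lemma applyGate_apply (U : Matrix Bool Bool ℂ) (c : Cell) (v : QState) (u : Finset Cell) :
    applyGate U c v u = ∑ b : Bool, U (decide (c ∈ u)) b * v (setBit u c b) := by
  unfold applyGate
  induction v using Finsupp.induction_linear with
  | zero => simp
  | add f g hf hg =>
    rw [Finsupp.sum_add_index', Finsupp.add_apply, hf, hg, ← Finset.sum_add_distrib]
    · simp [mul_add]
    · simp
    · intro s a b
      simp [mul_add, Finsupp.single_add, add_add_add_comm]
  | single s a =>
    rw [Finsupp.sum_single_index (by simp)]
    rw [Finsupp.finsetSum_apply]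
    -- A basis state contributes to the amplitude at `u` only if it agrees with `u` off the qubit
    -- `c`.
    by_cases h : s = setBit u c (decide (c ∈ s))
    · rw [Finset.sum_eq_single (decide (c ∈ u)), Finset.sum_eq_single (decide (c ∈ s))]
      · rw [Finsupp.single_apply, if_pos (setBit_eq_iff.2 ⟨rfl, h⟩), ← h, Finsupp.single_eq_same]
      · intro b _ hb
        rw [Finsupp.single_apply, if_neg, mul_zero]
        intro h'
        apply hb
        rw [h']
        simp [mem_setBit]
      · simp
      · intro b _ hb
        rw [Finsupp.single_apply, if_neg]
        exact fun h' => hb (setBit_eq_iff.1 h').1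
      · simp
    · rw [Finset.sum_eq_zero, Finset.sum_eq_zero]
      · intro b _
        rw [Finsupp.single_apply, if_neg, mul_zero]
        rintro rfl
        apply h
        simp [mem_setBit]
      · intro b _
        rw [Finsupp.single_apply, if_neg]
        exact fun h' => h (setBit_eq_iff.1 h').2

/-- The permutation of the basis states that a controlled NOT performs. -/
def flipBit (c d : Cell) (s : Finset Cell) : Finset Cell :=
  if c ∈ s then setBit s d (decide (d ∉ s)) else s

lemma mem_flipBit {c d e : Cell} {s : Finset Cell} :
    e ∈ flipBit c d s ↔ if c ∈ s ∧ e = d then d ∉ s else e ∈ s := by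
  unfold flipBit
  by_cases h : c ∈ s <;> by_cases h' : e = d <;> simp [h, h', mem_setBit]

lemma flipBit_flipBit {c d : Cell} (h : c ≠ d) (s : Finset Cell) :
    flipBit c d (flipBit c d s) = s := by
  ext e
  by_cases hc : c ∈ s <;> by_cases he : e = d <;> simp [mem_flipBit, h, hc, he]

lemma applyCNOT_apply (c d : Cell) (v : QState) (u : Finset Cell) :
    applyCNOT c d v u = if c = d then v u else v (flipBit c d u) := by
  unfold applyCNOT
  split_ifs with h
  · rfl
  · have hinv : Function.Involutive (flipBit c d) := flipBit_flipBit h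
    conv_lhs => rw [← hinv u]
    exact Finsupp.mapDomain_apply hinv.injective v (flipBit c d u)

lemma project_apply (c : Cell) (b : Bool) (v : QState) (u : Finset Cell) :
    project c b v u = if decide (c ∈ u) = b then v u else 0 := by
  unfold project
  rw [Finsupp.filter_apply]

/-! ## The operations do not annihilate states -/

lemma sqNorm_eq_zero {v : QState} : sqNorm v = 0 ↔ v = 0 := by
  unfold sqNorm Finsupp.sum
  rw [Finset.sum_eq_zero_iff]
  constructor
  · intro h
    ext s
    by_contra hs
    have := h s (by simpa using hs)
    simp_all
  · rintro rfl
    simp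

lemma blank_ne_zero : blank ≠ 0 := by simp [blank]

lemma applyGate_mul (U U' : Matrix Bool Bool ℂ) (c : Cell) (v : QState) :
    applyGate U c (applyGate U' c v) = applyGate (U * U') c v := by
  ext u
  simp only [applyGate_apply, setBit_setBit, mem_setBit, Fintype.sum_bool, Matrix.mul_apply]
  simp
  ring

lemma applyGate_one (c : Cell) (v : QState) : applyGate 1 c v = v := by
  ext u
  rw [applyGate_apply, Finset.sum_eq_single (decide (c ∈ u))]
  · simp [setBit_self]
  · intro b _ hb
    rw [Matrix.one_apply_ne' hb, zero_mul]
  · simp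

lemma applyGate_zero (U : Matrix Bool Bool ℂ) (c : Cell) : applyGate U c 0 = 0 := by
  simp [applyGate]

/-- A left inverse of the matrix gives a left inverse of the gate. Nonvanishing has to be tracked
because states are not normalised, and the zero vector represents no state. -/
lemma applyGate_ne_zero {U U' : Matrix Bool Bool ℂ} (h : U' * U = 1) (c : Cell) {v : QState}
    (hv : v ≠ 0) : applyGate U c v ≠ 0 := by
  intro h0
  apply hv
  rw [← applyGate_one c v, ← h, ← applyGate_mul, h0, applyGate_zero]

lemma gateH_mul_gateH : gateH * gateH = 1 := by
  have h : (Real.sqrt 2 : ℂ) * (Real.sqrt 2 : ℂ) = 2 := by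
    rw [← Complex.ofReal_mul, Real.mul_self_sqrt (by norm_num)]
    norm_num
  have h0 : (Real.sqrt 2 : ℂ) ≠ 0 := fun h0 => by simp [h0] at h
  ext i j
  cases i <;> cases j <;>
    simp only [Matrix.mul_apply, gateH, Matrix.of_apply, Fintype.sum_bool, div_mul_div_comm, h] <;>
    norm_num

lemma inv_mul_gateT :
    (Matrix.diagonal fun b => if b then Complex.exp (-(Complex.I * Real.pi / 4)) else 1) * gateT
      = 1 := by
  rw [gateT, Matrix.diagonal_mul_diagonal, ← Matrix.diagonal_one]
  congr 1
  ext b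
  cases b
  · simp
  · simp [← Complex.exp_add]

lemma applyCNOT_ne_zero (c d : Cell) {v : QState} (hv : v ≠ 0) : applyCNOT c d v ≠ 0 := by
  intro h
  apply hv
  by_cases hcd : c = d
  · simpa [applyCNOT, hcd] using h
  · ext u
    have := DFunLike.congr_fun h (flipBit c d u)
    rwa [applyCNOT_apply, if_neg hcd, flipBit_flipBit hcd] at this

lemma outcome_apply_true (c : Cell) (v : QState) : outcome c v true = probOne c v := by
  simp [outcome]

lemma outcome_apply_false (c : Cell) (v : QState) :
    outcome c v false = 1 - (probOne c v : ℝ≥0∞) := by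
  simp [outcome]

/-- An outcome with vanishing projection has probability zero, so it is not in the support. -/
lemma project_ne_zero {c : Cell} {v : QState} (hv : v ≠ 0) {b : Bool}
    (hb : b ∈ (outcome c v).support) : project c b v ≠ 0 := by
  rw [PMF.mem_support_iff] at hb
  cases b
  · rintro h0
    apply hb
    -- If the part with outcome `0` vanishes, the whole vector lies in the part with outcome `1`,
    -- and `probOne` is `1`.
    have h1 : project c true v = v := by
      ext u
      have := DFunLike.congr_fun h0 u
      rw [project_apply] at this ⊢
      by_cases hu : c ∈ u <;> simp_all
    rw [outcome_apply_false, probOne, h1, div_self (mt sqNorm_eq_zero.1 hv)]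
    simp
  · rw [outcome_apply_true] at hb
    rintro h0
    apply hb
    simp [probOne, h0, sqNorm]

/-! ## Placing a state on other tapes -/

/-- Tape `r` is moved to tape `τ r`. -/
def moveCell (τ : ℕ ↪ ℕ) : Cell ↪ Cell := τ.prodMap (Function.Embedding.refl ℕ)

@[simp] lemma moveCell_apply (τ : ℕ ↪ ℕ) (c : Cell) : moveCell τ c = (τ c.1, c.2) := rfl

/-- The part of a basis state on the tapes `τ r`, moved back to the tapes `r`. -/
def pre (τ : ℕ ↪ ℕ) (u : Finset Cell) : Finset Cell :=
  u.preimage (moveCell τ) (moveCell τ).injective.injOn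

@[simp] lemma mem_pre {τ : ℕ ↪ ℕ} {u : Finset Cell} {c : Cell} :
    c ∈ pre τ u ↔ (τ c.1, c.2) ∈ u := by simp [pre]

open Classical in
/-- The part of a basis state outside the tapes `τ r`. -/
def rest (τ : ℕ ↪ ℕ) (u : Finset Cell) : Finset Cell := u.filter fun c => c.1 ∉ Set.range τ

lemma mem_rest {τ : ℕ ↪ ℕ} {u : Finset Cell} {c : Cell} :
    c ∈ rest τ u ↔ c ∈ u ∧ ∀ r, τ r ≠ c.1 := by simp [rest]

lemma map_pre_union_rest (τ : ℕ ↪ ℕ) (u : Finset Cell) :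
    (pre τ u).map (moveCell τ) ∪ rest τ u = u := by
  ext ⟨r, i⟩
  simp only [Finset.mem_union, Finset.mem_map, mem_pre, moveCell_apply, mem_rest, Prod.exists,
    Prod.mk.injEq]
  constructor
  · rintro (⟨a, b, h, rfl, rfl⟩ | h)
    · exact h
    · exact h.1
  · intro h
    by_cases hr : ∃ a, τ a = r
    · obtain ⟨a, rfl⟩ := hr
      exact Or.inl ⟨a, i, h, rfl, rfl⟩
    · exact Or.inr ⟨h, fun a ha => hr ⟨a, ha⟩⟩

/-- The product of `v`, with tape `r` moved to tape `τ r`, and the state `W` of the other tapes. -/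
def split (τ : ℕ ↪ ℕ) (v W : QState) : QState :=
  Finsupp.onFinset
    ((v.support ×ˢ W.support).image fun p => p.1.map (moveCell τ) ∪ p.2)
    (fun u => v (pre τ u) * W (rest τ u)) (by
      intro u hu
      rw [Finset.mem_image]
      refine ⟨(pre τ u, rest τ u), ?_, map_pre_union_rest τ u⟩
      rw [Finset.mem_product, Finsupp.mem_support_iff, Finsupp.mem_support_iff]
      exact ⟨left_ne_zero_of_mul hu, right_ne_zero_of_mul hu⟩)

lemma split_apply (τ : ℕ ↪ ℕ) (v W : QState) (u : Finset Cell) :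
    split τ v W u = v (pre τ u) * W (rest τ u) := rfl

/-- All qubits on the tapes `τ r` are in the state `|0⟩`. -/
def Avoids (τ : ℕ ↪ ℕ) (W : QState) : Prop := ∀ u ∈ W.support, ∀ c ∈ u, ∀ r, τ r ≠ c.1

lemma Avoids.eq_zero {τ : ℕ ↪ ℕ} {W : QState} (h : Avoids τ W) {u : Finset Cell} {c : Cell}
    (hc : c ∈ u) {r : ℕ} (hr : τ r = c.1) : W u = 0 := by
  by_contra h0
  exact h u (by simpa using h0) c hc r hr

lemma avoids_blank (τ : ℕ ↪ ℕ) : Avoids τ blank := by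
  intro u hu c hc
  unfold blank at hu
  have := Finsupp.support_single_subset hu
  simp_all

/-- A qubit on a tape `σ r` lies outside the range of `τ`, so it survives in `rest τ u`, where `W`
must be `|0⟩`. -/
lemma avoids_split {σ τ : ℕ ↪ ℕ} {v W : QState} (h : Avoids σ W) (hd : ∀ r t, σ r ≠ τ t) :
    Avoids σ (split τ v W) := by
  intro u hu c hc r hr
  have h0 : W (rest τ u) ≠ 0 := by
    rw [Finsupp.mem_support_iff, split_apply] at hu
    exact right_ne_zero_of_mul hu
  refine h0 (h.eq_zero (c := c) (mem_rest.2 ⟨hc, fun t ht => hd r t (hr.trans ht.symm)⟩) hr)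

lemma pre_map_union {τ : ℕ ↪ ℕ} {s t : Finset Cell} (ht : ∀ c ∈ t, ∀ r, τ r ≠ c.1) :
    pre τ (s.map (moveCell τ) ∪ t) = s := by
  ext ⟨r, i⟩
  have : (τ r, i) ∉ t := fun h => ht _ h r rfl
  simp [this]

lemma rest_map_union {τ : ℕ ↪ ℕ} {s t : Finset Cell} (ht : ∀ c ∈ t, ∀ r, τ r ≠ c.1) :
    rest τ (s.map (moveCell τ) ∪ t) = t := by
  ext ⟨r, i⟩
  simp only [mem_rest, Finset.mem_union, Finset.mem_map, moveCell_apply, Prod.mk.injEq, Prod.exists]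
  constructor
  · rintro ⟨⟨a, b, -, rfl, rfl⟩ | h, h'⟩
    · exact absurd rfl (h' a)
    · exact h
  · exact fun h => ⟨Or.inr h, ht _ h⟩

/-- Basis states correspond to pairs `(pre τ u, rest τ u)`, and amplitudes multiply. `Avoids τ W` is
essential: components of `W` with a `1` on a tape `τ r` are never read by `split` and would be lost.
-/
lemma sqNorm_split {τ : ℕ ↪ ℕ} {W : QState} (hW : Avoids τ W) (v : QState) :
    sqNorm (split τ v W) = sqNorm v * sqNorm W := by
  unfold sqNorm Finsupp.sum
  rw [Finset.sum_mul_sum, ← Finset.sum_product']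
  refine Finset.sum_bij' (fun u _ => (pre τ u, rest τ u))
    (fun p _ => p.1.map (moveCell τ) ∪ p.2) ?_ ?_ ?_ ?_ ?_
  · intro u hu
    rw [Finsupp.mem_support_iff, split_apply] at hu
    rw [Finset.mem_product, Finsupp.mem_support_iff, Finsupp.mem_support_iff]
    exact ⟨left_ne_zero_of_mul hu, right_ne_zero_of_mul hu⟩
  · rintro ⟨s, t⟩ hp
    rw [Finset.mem_product] at hp
    have ht := hW t hp.2
    rw [Finsupp.mem_support_iff, split_apply]
    dsimp only
    rw [pre_map_union ht, rest_map_union ht]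
    exact mul_ne_zero (Finsupp.mem_support_iff.1 hp.1) (Finsupp.mem_support_iff.1 hp.2)
  · exact fun u _ => map_pre_union_rest τ u
  · rintro ⟨s, t⟩ hp
    rw [Finset.mem_product] at hp
    have ht := hW t hp.2
    dsimp only
    rw [pre_map_union ht, rest_map_union ht]
  · intro u _
    simp only [split_apply, nnnorm_mul, mul_pow]

lemma split_ne_zero {τ : ℕ ↪ ℕ} {v W : QState} (hW : Avoids τ W) (hv : v ≠ 0) (h : W ≠ 0) :
    split τ v W ≠ 0 := by
  rw [Ne, ← sqNorm_eq_zero, sqNorm_split hW]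
  exact mul_ne_zero (mt sqNorm_eq_zero.1 hv) (mt sqNorm_eq_zero.1 h)

lemma pre_setBit (τ : ℕ ↪ ℕ) (u : Finset Cell) (r i : ℕ) (b : Bool) :
    pre τ (setBit u (τ r, i) b) = setBit (pre τ u) (r, i) b := by
  ext ⟨a, j⟩
  simp [mem_setBit]

lemma rest_setBit (τ : ℕ ↪ ℕ) (u : Finset Cell) (r i : ℕ) (b : Bool) :
    rest τ (setBit u (τ r, i) b) = rest τ u := by
  ext ⟨a, j⟩
  simp only [mem_rest, mem_setBit, Prod.mk.injEq]
  refine and_congr_left fun h => ?_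
  rw [if_neg]
  exact fun h' => h r h'.1.symm

lemma split_applyGate (U : Matrix Bool Bool ℂ) (τ : ℕ ↪ ℕ) (r i : ℕ) (v W : QState) :
    split τ (applyGate U (r, i) v) W = applyGate U (τ r, i) (split τ v W) := by
  ext u
  simp only [split_apply, applyGate_apply, pre_setBit, rest_setBit, Finset.sum_mul, mem_pre,
    mul_assoc]

lemma split_applyCNOT (τ : ℕ ↪ ℕ) (r i s j : ℕ) (v W : QState) :
    split τ (applyCNOT (r, i) (s, j) v) W = applyCNOT (τ r, i) (τ s, j) (split τ v W) := by
  ext u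
  simp only [split_apply, applyCNOT_apply, Prod.mk.injEq, τ.injective.eq_iff]
  split_ifs with h
  · rfl
  · congr 2
    · ext ⟨a, k⟩
      simp [mem_flipBit]
    · unfold flipBit
      split_ifs
      · rw [rest_setBit]
      · rfl

lemma split_project (τ : ℕ ↪ ℕ) (r i : ℕ) (b : Bool) (v W : QState) :
    split τ (project (r, i) b v) W = project (τ r, i) b (split τ v W) := by
  ext u
  simp only [split_apply, project_apply, mem_pre, ite_mul, zero_mul]

/-- Measuring one tensor factor: the squared norm of the other factor cancels in the ratio of
squared norms. -/
lemma outcome_split {τ : ℕ ↪ ℕ} {W : QState} (hW : Avoids τ W) (h : W ≠ 0) (r i : ℕ)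
    (v : QState) : outcome (τ r, i) (split τ v W) = outcome (r, i) v := by
  have : probOne (τ r, i) (split τ v W) = probOne (r, i) v := by
    unfold probOne
    rw [← split_project, sqNorm_split hW, sqNorm_split hW,
      mul_div_mul_right _ _ (mt sqNorm_eq_zero.1 h)]
  ext b
  cases b
  · rw [outcome_apply_false, outcome_apply_false, this]
  · rw [outcome_apply_true, outcome_apply_true, this]

/-! ## Rearranging products -/

lemma blank_apply (u : Finset Cell) : blank u = if u = ∅ then 1 else 0 := by
  simp only [blank, Finsupp.single_apply, eq_comm]

/-- Unused tapes count as a blank tensor factor. This supplies a subroutine with work tapes and with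
its missing quantum inputs. -/
lemma Avoids.eq_split {τ : ℕ ↪ ℕ} {W : QState} (h : Avoids τ W) : W = split τ blank W := by
  ext u
  rw [split_apply, blank_apply]
  by_cases hu : ∀ c ∈ u, ∀ r, τ r ≠ c.1
  · have h1 : pre τ u = ∅ := by
      ext c
      simpa using fun hc => hu _ hc c.1 rfl
    have h2 : rest τ u = u := by
      ext c
      simpa [mem_rest] using hu c
    rw [h1, h2, if_pos rfl, one_mul]
  · push Not at hu
    obtain ⟨c, hc, r, hr⟩ := hu
    rw [h.eq_zero hc hr, if_neg, zero_mul]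
    refine Finset.Nonempty.ne_empty ⟨(r, c.2), ?_⟩
    rw [mem_pre, hr]
    exact hc

lemma pre_rest {σ τ : ℕ ↪ ℕ} (h : ∀ r t, σ r ≠ τ t) (u : Finset Cell) :
    pre σ (rest τ u) = pre σ u := by
  ext c
  simp only [mem_pre, mem_rest, and_iff_left_iff_imp]
  exact fun _ r => (h c.1 r).symm

lemma split_comm {σ τ : ℕ ↪ ℕ} (h : ∀ r t, σ r ≠ τ t) (v w W : QState) :
    split σ v (split τ w W) = split τ w (split σ v W) := by
  ext u
  have : rest τ (rest σ u) = rest σ (rest τ u) := by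
    ext c
    simp only [mem_rest]
    tauto
  simp only [split_apply]
  rw [pre_rest h, pre_rest fun t r => (h r t).symm, this]
  ring

lemma split_blank (τ : ℕ ↪ ℕ) : split τ blank blank = blank :=
  (avoids_blank τ).eq_split.symm

lemma split_refl (v : QState) : split (Function.Embedding.refl ℕ) v blank = v := by
  ext u
  have h1 : pre (Function.Embedding.refl ℕ) u = u := by ext; simp
  have h2 : rest (Function.Embedding.refl ℕ) u = ∅ := by ext; simp [mem_rest]
  rw [split_apply, h1, h2, blank_apply, if_pos rfl, mul_one]

/-- The tapes of the first quantum input. -/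
def tapesA : ℕ ↪ ℕ := ⟨fun r => 3 * r, fun a b h => by simp only at h; omega⟩

/-- The tapes of the second quantum input. -/
def tapesB : ℕ ↪ ℕ := ⟨fun r => 3 * r + 1, fun a b h => by simp only at h; omega⟩

@[simp] lemma tapesA_apply (r : ℕ) : tapesA r = 3 * r := rfl
@[simp] lemma tapesB_apply (r : ℕ) : tapesB r = 3 * r + 1 := rfl

lemma tensor_eq_split (ψ φ : QState) : tensor ψ φ = split tapesA ψ (split tapesB φ blank) := by
  ext u
  unfold tensor
  have h1 : ∀ s : Finset Cell, s.image (fun c => (3 * c.1, c.2)) = s.map (moveCell tapesA) := by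
    intro s
    ext c
    simp
  have h2 : ∀ s : Finset Cell,
      s.image (fun c => (3 * c.1 + 1, c.2)) = s.map (moveCell tapesB) := by
    intro s
    ext c
    simp
  simp only [h1, h2, Finsupp.sum, Finsupp.finsetSum_apply, split_apply, blank_apply]
  have hA : ∀ t : Finset Cell, ∀ c ∈ t.map (moveCell tapesB), ∀ r, tapesA r ≠ c.1 := by
    intro t c hc r
    obtain ⟨d, -, rfl⟩ := Finset.mem_map.1 hc
    simp
    omega
  -- At most one pair of basis states contributes to the amplitude at `u`, and there is one only if
  -- no tape outside the two input classes holds a `1`.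
  have key : ∀ s t : Finset Cell, s.map (moveCell tapesA) ∪ t.map (moveCell tapesB) = u ↔
      s = pre tapesA u ∧ t = pre tapesB (rest tapesA u) ∧ rest tapesB (rest tapesA u) = ∅ := by
    intro s t
    have hB : t.map (moveCell tapesB) = t.map (moveCell tapesB) ∪ ∅ := by simp
    constructor
    · rintro rfl
      rw [pre_map_union (hA t), rest_map_union (hA t), hB, pre_map_union (by simp),
        rest_map_union (by simp)]
      simp
    · rintro ⟨hs, ht, h⟩
      conv_rhs => rw [← map_pre_union_rest tapesA u, ← map_pre_union_rest tapesB (rest tapesA u)]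
      rw [h, ← hs, ← ht, Finset.union_empty]
  rw [Finset.sum_eq_single (pre tapesA u), Finset.sum_eq_single (pre tapesB (rest tapesA u))]
  · rw [Finsupp.single_apply]
    simp only [key, true_and]
    split_ifs <;> simp
  · intro t _ ht
    rw [Finsupp.single_apply, if_neg]
    exact fun h => ht ((key _ _).1 h).2.1
  · intro h
    rw [Finsupp.notMem_support_iff.1 h]
    simp
  · intro s _ hs
    refine Finset.sum_eq_zero fun t _ => ?_
    rw [Finsupp.single_apply, if_neg]
    exact fun h => hs ((key _ _).1 h).1
  · intro h
    rw [Finsupp.notMem_support_iff.1 h]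
    simp

lemma tensor_blank_blank : tensor blank blank = blank := by
  rw [tensor_eq_split, split_blank, split_blank]

lemma tensor_ne_zero {ψ φ : QState} (hψ : ψ ≠ 0) (hφ : φ ≠ 0) : tensor ψ φ ≠ 0 := by
  rw [tensor_eq_split]
  refine split_ne_zero (avoids_split (avoids_blank _) fun r t => ?_) hψ
    (split_ne_zero (avoids_blank _) hφ blank_ne_zero)
  simp
  omega

lemma tensor_blank (ψ : QState) : tensor ψ blank = split tapesA ψ blank := by
  rw [tensor_eq_split, split_blank]

/-- The input tapes are taken from `α` and `β`, the other ones from `γ`. -/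
def mix (α β γ : ℕ ↪ ℕ) (h₁ : ∀ r t, α r ≠ β t) (h₂ : ∀ r t, α r ≠ γ t)
    (h₃ : ∀ r t, β r ≠ γ t) : ℕ ↪ ℕ :=
  ⟨fun r => if r % 3 = 0 then α (r / 3) else if r % 3 = 1 then β (r / 3) else γ r, by
    intro a b h
    simp only at h
    split_ifs at h
    all_goals first
      | exact γ.injective h
      | exact absurd h (h₁ _ _)
      | exact absurd h (h₂ _ _)
      | exact absurd h (h₃ _ _)
      | exact absurd h.symm (h₁ _ _)
      | exact absurd h.symm (h₂ _ _)
      | exact absurd h.symm (h₃ _ _)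
      | have := α.injective h; omega
      | have := β.injective h; omega⟩

lemma mix_apply {α β γ : ℕ ↪ ℕ} (h₁ : ∀ r t, α r ≠ β t) (h₂ : ∀ r t, α r ≠ γ t)
    (h₃ : ∀ r t, β r ≠ γ t) (r : ℕ) :
    mix α β γ h₁ h₂ h₃ r =
      if r % 3 = 0 then α (r / 3) else if r % 3 = 1 then β (r / 3) else γ r := rfl

lemma mix_cases {α β γ : ℕ ↪ ℕ} (h₁ : ∀ r t, α r ≠ β t) (h₂ : ∀ r t, α r ≠ γ t)
    (h₃ : ∀ r t, β r ≠ γ t) (r : ℕ) :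
    (∃ t, mix α β γ h₁ h₂ h₃ r = α t) ∨ (∃ t, mix α β γ h₁ h₂ h₃ r = β t) ∨
      ∃ t, mix α β γ h₁ h₂ h₃ r = γ t := by
  rw [mix_apply]
  split_ifs
  · exact Or.inl ⟨_, rfl⟩
  · exact Or.inr (Or.inl ⟨_, rfl⟩)
  · exact Or.inr (Or.inr ⟨_, rfl⟩)

/-- Two states already lying on the tapes of `α` and `β` become the inputs of a subroutine by a
choice of tape names, without moving any qubit. Only the tapes `γ r` with `r % 3 = 2` serve as work
tapes. -/
lemma split_split_eq_split_tensor {α β γ : ℕ ↪ ℕ} (h₁ : ∀ r t, α r ≠ β t)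
    (h₂ : ∀ r t, α r ≠ γ t) (h₃ : ∀ r t, β r ≠ γ t) {W : QState} (hW : Avoids γ W)
    (ψ φ : QState) :
    split α ψ (split β φ W) = split (mix α β γ h₁ h₂ h₃) (tensor ψ φ) W := by
  ext u
  set δ := mix α β γ h₁ h₂ h₃ with hδ
  have hδA : ∀ r, δ (3 * r) = α r := by
    intro r
    have e : 3 * r / 3 = r := by omega
    simp [hδ, mix_apply, e]
  have hδB : ∀ r, δ (3 * r + 1) = β r := by
    intro r
    have e : (3 * r + 1) / 3 = r := by omega
    have e' : (3 * r + 1) % 3 = 1 := by omega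
    simp [hδ, mix_apply, e, e']
  have hδC : ∀ r, r % 3 = 2 → δ r = γ r := by
    intro r e
    simp [hδ, mix_apply, e]
  have hAB : ∀ r t, tapesB r ≠ tapesA t := fun r t => by simp; omega
  rw [tensor_eq_split]
  simp only [split_apply, blank_apply]
  rw [pre_rest hAB, pre_rest fun r t => (h₁ t r).symm]
  have e1 : pre tapesA (pre δ u) = pre α u := by ext; simp [hδA]
  have e2 : pre tapesB (pre δ u) = pre β u := by ext; simp [hδB]
  rw [e1, e2]
  -- If a work tape holds a `1`, both sides vanish: on the left `W` is blank there, on the right the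
  -- tensor product is. Otherwise both sides leave the same rest to `W`.
  by_cases hu : ∃ r i, (γ r, i) ∈ u ∧ r % 3 = 2
  · obtain ⟨r, i, hr, hr3⟩ := hu
    rw [hW.eq_zero (c := (γ r, i)) (r := r) _ rfl, if_neg]
    · ring
    · refine Finset.Nonempty.ne_empty ⟨(r, i), ?_⟩
      simp only [mem_rest, mem_pre, hδC r hr3, tapesA_apply, tapesB_apply]
      refine ⟨⟨hr, ?_⟩, ?_⟩ <;> intro t <;> omega
    · simp only [mem_rest]
      exact ⟨⟨hr, fun t => h₂ t r⟩, fun t => h₃ t r⟩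
  · push Not at hu
    have e3 : rest tapesB (rest tapesA (pre δ u)) = ∅ := by
      ext ⟨r, i⟩
      simp only [mem_rest, mem_pre, tapesA_apply, tapesB_apply, Finset.notMem_empty, iff_false]
      rintro ⟨⟨hr, hrA⟩, hrB⟩
      have h3 : r % 3 = 2 := by
        have := hrA (r / 3)
        have := hrB (r / 3)
        omega
      rw [hδC r h3] at hr
      exact hu r i hr h3
    rw [e3, if_pos rfl]
    have e4 : rest β (rest α u) = rest δ u := by
      ext ⟨r, i⟩
      simp only [mem_rest]
      constructor
      · rintro ⟨⟨hr, hrA⟩, hrB⟩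
        refine ⟨hr, fun t ht => ?_⟩
        by_cases h0 : t % 3 = 2
        · rw [hδC t h0] at ht
          exact hu t i (ht ▸ hr) h0
        · by_cases h1 : t % 3 = 0
          · apply hrA (t / 3)
            rw [← hδA, ← ht]
            congr 1
            omega
          · apply hrB (t / 3)
            rw [← hδB, ← ht]
            congr 1
            omega
      · rintro ⟨hr, hr'⟩
        exact ⟨⟨hr, fun t => hδA t ▸ hr' _⟩, fun t => hδB t ▸ hr' _⟩
    rw [e4]
    ring

/-! ## Execution -/

lemma bind_congr_of_support {α β : Type*} {p : PMF α} {f g : α → PMF β}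
    (h : ∀ a ∈ p.support, f a = g a) : p.bind f = p.bind g := by
  ext b
  rw [PMF.bind_apply, PMF.bind_apply]
  refine tsum_congr fun a => ?_
  by_cases ha : p a = 0
  · rw [ha, zero_mul, zero_mul]
  · rw [h a ((PMF.mem_support_iff _ _).2 ha)]

lemma steps_of_halted {c : Config} (h : c.todo = []) (T : ℕ) : steps T c = PMF.pure c := by
  induction T with
  | zero => rfl
  | succ T ih =>
    have : step c = PMF.pure c := by
      unfold step
      rw [h]
    rw [steps, this, PMF.pure_bind, ih]

lemma steps_add (T T' : ℕ) (c : Config) : steps (T + T') c = (steps T c).bind (steps T') := by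
  induction T generalizing c with
  | zero => rw [Nat.zero_add, steps, PMF.pure_bind]
  | succ T ih =>
    rw [Nat.add_right_comm, steps, steps, PMF.bind_bind]
    congr 1
    ext1 c'
    exact ih c'

/-- Halted configurations are fixed by `step`, so a step budget may be enlarged freely. -/
lemma steps_add_of_halted {T : ℕ} {c : Config} (h : ∀ c' ∈ (steps T c).support, c'.todo = [])
    (m : ℕ) : steps (T + m) c = steps T c := by
  rw [steps_add, bind_congr_of_support (g := PMF.pure), PMF.bind_pure]
  exact fun c' hc' => steps_of_halted (h c' hc') m

lemma steps_invariant {I : Config → Prop} (h : ∀ c, I c → ∀ c' ∈ (step c).support, I c')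
    {c : Config} (hc : I c) (T : ℕ) : ∀ c' ∈ (steps T c).support, I c' := by
  induction T generalizing c with
  | zero =>
    intro c' hc'
    rw [steps, PMF.support_pure, Set.mem_singleton_iff] at hc'
    exact hc' ▸ hc
  | succ T ih =>
    intro c' hc'
    rw [steps, PMF.mem_support_bind_iff] at hc'
    obtain ⟨c'', h1, h2⟩ := hc'
    exact ih (h c hc c'' h1) c' h2

lemma Instr.one_le_cost (g : Regs) (o : Instr) : 1 ≤ o.cost g := by
  cases o <;> simp only [Instr.cost] <;> omega

lemma clock_lt_of_mem_step {c c' : Config} (h : c.todo ≠ []) (hc' : c' ∈ (step c).support) :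
    c.clock + 1 ≤ c'.clock := by
  unfold step at hc'
  split at hc'
  · exact absurd ‹_› h
  · simp only [PMF.support_pure, Set.mem_singleton_iff] at hc'
    simp [hc']
  · simp only [PMF.support_map, Set.mem_image] at hc'
    obtain ⟨s, -, rfl⟩ := hc'
    exact Nat.add_le_add_left (Instr.one_le_cost _ _) _
  all_goals
    simp only [PMF.support_pure, Set.mem_singleton_iff] at hc'
    simp [hc']

lemma clock_le_of_mem_step {c c' : Config} (hc' : c' ∈ (step c).support) :
    c.clock ≤ c'.clock := by
  by_cases h : c.todo = []
  · rw [step] at hc'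
    simp_all
  · exact (Nat.le_succ _).trans (clock_lt_of_mem_step h hc')

/-- The configuration with further programs to be executed, and with the clock set forward. -/
def Config.plug (k : List Prog) (t : ℕ) (c : Config) : Config :=
  ⟨c.todo ++ k, c.regs, c.mem, c.clock + t⟩

lemma step_plug (k : List Prog) (t : ℕ) {c : Config} (h : c.todo ≠ []) :
    step (c.plug k t) = (step c).map (Config.plug k t) := by
  obtain ⟨todo, g, v, s⟩ := c
  match todo with
  | [] => exact absurd rfl h
  | Prog.skip :: l => simp [step, Config.plug, PMF.pure_map, Nat.add_right_comm]
  | Prog.instr o :: l =>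
    simp only [step, Config.plug, List.cons_append, PMF.map_comp]
    congr 1
    funext x
    simp [Config.plug, Nat.add_right_comm]
  | Prog.seq P Q :: l => simp [step, Config.plug, PMF.pure_map, Nat.add_right_comm]
  | Prog.ite x P Q :: l =>
    cases hx : (g x).isNil <;> simp [step, Config.plug, PMF.pure_map, Nat.add_right_comm, hx]
  | Prog.loop x P :: l =>
    cases hx : (g x).isNil <;> simp [step, Config.plug, PMF.pure_map, Nat.add_right_comm, hx]

/-- Here `T` is only an upper bound: some random branches finish early and enter the continuation
sooner. The hypothesis that the continuation halts within `T'` steps makes the extra steps harmless.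
-/
lemma steps_plug (k : List Prog) (t : ℕ) {T T' : ℕ} {c : Config}
    (h : ∀ c' ∈ (steps T c).support, c'.todo = [] ∧
      ∀ c'' ∈ (steps T' (c'.plug k t)).support, c''.todo = []) :
    steps (T + T') (c.plug k t) = (steps T c).bind fun c' => steps T' (c'.plug k t) := by
  induction T generalizing c with
  | zero => rw [Nat.zero_add, steps, PMF.pure_bind]
  | succ T ih =>
    -- On an early halt the continuation has more than `T'` steps available, and it is already
    -- settled after `T'`.
    by_cases hc : c.todo = []
    · rw [steps_of_halted hc] at h ⊢
      rw [PMF.pure_bind, Nat.add_comm, steps_add_of_halted]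
      refine (h c ?_).2
      rw [PMF.support_pure, Set.mem_singleton_iff]
    · rw [Nat.add_right_comm, steps, step_plug k t hc, PMF.bind_map, steps, PMF.bind_bind]
      refine bind_congr_of_support fun c' hc' => ih fun c'' hc'' => h c'' ?_
      rw [steps, PMF.mem_support_bind_iff]
      exact ⟨c', hc', hc''⟩

lemma steps_plug_nil (t T : ℕ) (c : Config) :
    steps T (c.plug [] t) = (steps T c).map (Config.plug [] t) := by
  induction T generalizing c with
  | zero => rw [steps, steps, PMF.pure_map]
  | succ T ih =>
    by_cases hc : c.todo = []
    · rw [steps_of_halted hc, steps_of_halted (by simp [Config.plug, hc]), PMF.pure_map]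
    · rw [steps, step_plug _ _ hc, PMF.bind_map, steps, PMF.map_bind]
      congr 1
      funext c'
      exact ih c'

/-! ## States stay nonzero, and small -/

lemma Instr.mem_ne_zero {g : Regs} {v : QState} (hv : v ≠ 0) (o : Instr) :
    ∀ s ∈ (o.exec g v).support, s.2 ≠ 0 := by
  intro s hs
  cases o <;> simp only [Instr.exec, PMF.support_pure, Set.mem_singleton_iff, PMF.support_map,
    Set.mem_image] at hs
  case had r x => exact hs ▸ applyGate_ne_zero gateH_mul_gateH _ hv
  case phase r x => exact hs ▸ applyGate_ne_zero inv_mul_gateT _ hv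
  case cnot r x r' y => exact hs ▸ applyCNOT_ne_zero _ _ hv
  case meas r x z =>
    obtain ⟨b, hb, rfl⟩ := hs
    exact project_ne_zero hv hb
  all_goals exact hs ▸ hv

lemma mem_ne_zero_of_mem_step {c : Config} (h : c.mem ≠ 0) :
    ∀ c' ∈ (step c).support, c'.mem ≠ 0 := by
  intro c' hc'
  unfold step at hc'
  split at hc'
  case h_3 =>
    simp only [PMF.support_map, Set.mem_image] at hc'
    obtain ⟨s, hs, rfl⟩ := hc'
    exact Instr.mem_ne_zero h _ s hs
  all_goals
    simp only [PMF.support_pure, Set.mem_singleton_iff] at hc'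
    simpa [hc'] using h

/-- The registers and the tapes in use have length at most `M`. -/
def Small (M : ℕ) (g : Regs) (v : QState) : Prop := (∀ r, (g r).size ≤ M) ∧ qlen v ≤ M

lemma Small.mono {M M' : ℕ} {g : Regs} {v : QState} (h : Small M g v) (hM : M ≤ M') :
    Small M' g v :=
  ⟨fun r => (h.1 r).trans hM, h.2.trans hM⟩

lemma qlen_le_iff {v : QState} {m : ℕ} : qlen v ≤ m ↔ ∀ s, v s ≠ 0 → ∀ c ∈ s, c.2 + 1 ≤ m := by
  simp [qlen, Finset.sup_le_iff]

lemma Data.one_le_size (d : Data) : 1 ≤ d.size := by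
  cases d <;> simp [Data.size]

lemma Data.length_lt_size (d : Data) : d.length + 1 ≤ d.size := by
  induction d with
  | nil => simp [Data.length, Data.size]
  | cons a b _ ih => simp only [Data.length, Data.size]; omega

lemma Data.size_fst_le (d : Data) : d.fst.size ≤ d.size := by
  cases d with
  | nil => exact le_rfl
  | cons a b => simp only [Data.fst, Data.size]; omega

lemma Data.size_snd_le (d : Data) : d.snd.size ≤ d.size := by
  cases d with
  | nil => exact le_rfl
  | cons a b => simp only [Data.snd, Data.size]; omega

lemma Data.size_ofBool_le (b : Bool) : (Data.ofBool b).size ≤ 3 := by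
  cases b <;> simp [Data.ofBool, Data.size]

lemma small_update {M m : ℕ} {g : Regs} {v : QState} (h : Small M g v) (x : ℕ) {d : Data}
    (hd : d.size ≤ M + m) : Small (M + m) (Function.update g x d) v := by
  refine ⟨fun r => ?_, h.2.trans (Nat.le_add_right _ _)⟩
  by_cases hr : r = x
  · subst hr; simpa using hd
  · simpa [hr] using (h.1 r).trans (Nat.le_add_right _ _)

lemma qlen_le_of_setBit {v v' : QState} {c : Cell} {M : ℕ} (hv : qlen v ≤ M) (hc : c.2 + 1 ≤ M)
    (h : ∀ u, v' u ≠ 0 → ∃ b, v (setBit u c b) ≠ 0) : qlen v' ≤ M := by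
  rw [qlen_le_iff] at hv ⊢
  intro u hu d hd
  obtain ⟨b, hb⟩ := h u hu
  by_cases hdc : d = c
  · rwa [hdc]
  · exact hv _ hb d (by rw [mem_setBit, if_neg hdc]; exact hd)

lemma qlen_applyGate_le {v : QState} {c : Cell} {M : ℕ} (hv : qlen v ≤ M) (hc : c.2 + 1 ≤ M)
    (U : Matrix Bool Bool ℂ) : qlen (applyGate U c v) ≤ M := by
  refine qlen_le_of_setBit hv hc fun u hu => ?_
  rw [applyGate_apply] at hu
  obtain ⟨b, -, hb⟩ := Finset.exists_ne_zero_of_sum_ne_zero hu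
  exact ⟨b, right_ne_zero_of_mul hb⟩

lemma qlen_applyCNOT_le {v : QState} {d : Cell} {M : ℕ} (hv : qlen v ≤ M) (hd : d.2 + 1 ≤ M)
    (c : Cell) : qlen (applyCNOT c d v) ≤ M := by
  refine qlen_le_of_setBit hv hd fun u hu => ?_
  rw [applyCNOT_apply] at hu
  unfold flipBit at hu
  split_ifs at hu
  · exact ⟨_, (setBit_self u d).symm ▸ hu⟩
  · exact ⟨_, hu⟩
  · exact ⟨_, (setBit_self u d).symm ▸ hu⟩

lemma qlen_project_le {v : QState} {M : ℕ} (hv : qlen v ≤ M) (c : Cell) (b : Bool) :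
    qlen (project c b v) ≤ M := by
  rw [qlen_le_iff] at hv ⊢
  intro u hu
  rw [project_apply] at hu
  split_ifs at hu
  · exact hv u hu
  · exact absurd rfl hu

/-- The cost of an instruction counts the nodes of its operands, so it pays for the result. The
extra `1` is needed for a measurement, whose outcome may have three nodes while its cost may be only
two. -/
lemma Instr.small {M : ℕ} {g : Regs} {v : QState} (h : Small (M + 1) g v) (o : Instr) :
    ∀ s ∈ (o.exec g v).support, Small (M + o.cost g + 1) s.1 s.2 := by
  intro s hs
  have hlen := fun r => (g r).length_lt_size
  have hone := fun r => (g r).one_le_size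
  have hmono : Small (M + o.cost g + 1) g v := h.mono (by omega)
  have hup : ∀ (x : ℕ) (d : Data) (m : ℕ), o.cost g = m → d.size ≤ m + 1 →
      Small (M + o.cost g + 1) (Function.update g x d) v := by
    rintro x d m rfl hd
    have := small_update (m := o.cost g) h x (d := d) (by omega)
    exact this.mono (by omega)
  cases o <;> simp only [Instr.exec, PMF.support_pure, Set.mem_singleton_iff, PMF.support_map,
    Set.mem_image] at hs
  case clear x => exact hs ▸ hup x _ _ rfl (by simp [Data.size])
  case copy x y => exact hs ▸ hup x _ _ rfl (by simp only [Instr.cost]; omega)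
  case cons x y z => exact hs ▸ hup x _ _ rfl (by simp only [Instr.cost, Data.size]; omega)
  case fst x y =>
    exact hs ▸ hup x _ _ rfl (by simp only [Instr.cost]; linarith [(g y).size_fst_le])
  case snd x y =>
    exact hs ▸ hup x _ _ rfl (by simp only [Instr.cost]; linarith [(g y).size_snd_le])
  case had r x =>
    subst hs
    exact ⟨hmono.1, qlen_applyGate_le hmono.2 (by have := hlen x; simp only [Instr.cost]; omega) _⟩
  case phase r x =>
    subst hs
    exact ⟨hmono.1, qlen_applyGate_le hmono.2 (by have := hlen x; simp only [Instr.cost]; omega) _⟩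
  case cnot r x r' y =>
    subst hs
    exact ⟨hmono.1, qlen_applyCNOT_le hmono.2 (by have := hlen y; simp only [Instr.cost]; omega) _⟩
  case meas r x z =>
    obtain ⟨b, -, rfl⟩ := hs
    have := hup z (Data.ofBool b) _ rfl
      (by have := Data.size_ofBool_le b
          have := hone x
          simp only [Instr.cost]; omega)
    exact ⟨this.1, qlen_project_le this.2 _ _⟩

lemma small_of_mem_step {M : ℕ} {c : Config} (h : Small (M + c.clock + 1) c.regs c.mem) :
    ∀ c' ∈ (step c).support, Small (M + c'.clock + 1) c'.regs c'.mem := by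
  intro c' hc'
  have hclock := clock_le_of_mem_step hc'
  unfold step at hc'
  split at hc'
  case h_3 o _ _ =>
    simp only [PMF.support_map, Set.mem_image] at hc'
    obtain ⟨s, hs, rfl⟩ := hc'
    have := Instr.small h o s hs
    exact this.mono (by simp only; omega)
  all_goals
    simp only [PMF.support_pure, Set.mem_singleton_iff] at hc'
    have := h.mono (M' := M + c'.clock + 1) (by omega)
    simpa [hc'] using this

/-- Memory never outgrows the initial size plus the elapsed time. This is what keeps composed time
bounds polynomial. -/
lemma small_of_mem_steps {M : ℕ} {c : Config} (h : Small M c.regs c.mem) (T : ℕ) :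
    ∀ c' ∈ (steps T c).support, Small (M + c'.clock + 1) c'.regs c'.mem :=
  steps_invariant (I := fun c => Small (M + c.clock + 1) c.regs c.mem)
    (fun _ => small_of_mem_step) (h.mono (by omega)) T

/-! ## Renaming of registers and tapes -/

/-- The instruction with register `i` renamed to `ρ i` and tape `r` renamed to `τ r`. -/
def Instr.rename (ρ τ : ℕ ↪ ℕ) : Instr → Instr
  | clear x => clear (ρ x)
  | copy x y => copy (ρ x) (ρ y)
  | cons x y z => cons (ρ x) (ρ y) (ρ z)
  | fst x y => fst (ρ x) (ρ y)
  | snd x y => snd (ρ x) (ρ y)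
  | had r x => had (τ r) (ρ x)
  | phase r x => phase (τ r) (ρ x)
  | cnot r x s y => cnot (τ r) (ρ x) (τ s) (ρ y)
  | meas r x z => meas (τ r) (ρ x) (ρ z)

/-- The program with register `i` renamed to `ρ i` and tape `r` renamed to `τ r`. -/
def Prog.rename (ρ τ : ℕ ↪ ℕ) : Prog → Prog
  | skip => skip
  | instr o => instr (o.rename ρ τ)
  | seq P Q => seq (P.rename ρ τ) (Q.rename ρ τ)
  | ite x P Q => ite (ρ x) (P.rename ρ τ) (Q.rename ρ τ)
  | loop x P => loop (ρ x) (P.rename ρ τ)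

lemma extend_update (ρ : ℕ ↪ ℕ) (g G : Regs) (x : ℕ) (d : Data) :
    Function.extend ρ (Function.update g x d) G = Function.update (Function.extend ρ g G) (ρ x) d := by
  funext r
  by_cases hr : ∃ i, ρ i = r
  · obtain ⟨i, rfl⟩ := hr
    rw [ρ.injective.extend_apply]
    by_cases hi : i = x
    · subst hi; simp
    · rw [Function.update_of_ne hi, Function.update_of_ne (ρ.injective.ne hi),
        ρ.injective.extend_apply]
  · rw [Function.extend_apply' _ _ _ hr, Function.update_of_ne, Function.extend_apply' _ _ _ hr]
    rintro rfl
    exact hr ⟨x, rfl⟩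

lemma Instr.cost_rename (ρ τ : ℕ ↪ ℕ) (g G : Regs) (o : Instr) :
    (o.rename ρ τ).cost (Function.extend ρ g G) = o.cost g := by
  cases o <;> simp [Instr.cost, Instr.rename, ρ.injective.extend_apply]

/-- The instruction acts on one tensor factor and on one block of registers; a measurement keeps its
distribution by `outcome_split`. -/
lemma Instr.exec_rename (ρ τ : ℕ ↪ ℕ) (G : Regs) {W : QState} (hW : Avoids τ W) (h : W ≠ 0)
    (g : Regs) (v : QState) (o : Instr) :
    (o.rename ρ τ).exec (Function.extend ρ g G) (split τ v W) =
      (o.exec g v).map fun s => (Function.extend ρ s.1 G, split τ s.2 W) := by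
  cases o
  case meas r x z =>
    simp only [Instr.exec, Instr.rename, ρ.injective.extend_apply, PMF.map_comp]
    rw [outcome_split hW h]
    congr 1
    funext b
    simp [extend_update, split_project]
  all_goals
    simp [Instr.exec, Instr.rename, PMF.pure_map, ρ.injective.extend_apply, extend_update,
      split_applyGate, split_applyCNOT]

/-- The configuration of a renamed program, with the contents `G` of the other registers and the
state `W` of the other tapes. -/
def Config.lift (ρ τ : ℕ ↪ ℕ) (G : Regs) (W : QState) (c : Config) : Config :=
  ⟨c.todo.map (Prog.rename ρ τ), Function.extend ρ c.regs G, split τ c.mem W, c.clock⟩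

lemma step_lift (ρ τ : ℕ ↪ ℕ) (G : Regs) {W : QState} (hW : Avoids τ W) (h : W ≠ 0)
    (c : Config) : step (c.lift ρ τ G W) = (step c).map (Config.lift ρ τ G W) := by
  obtain ⟨todo, g, v, s⟩ := c
  match todo with
  | [] => simp [step, Config.lift, PMF.pure_map]
  | Prog.skip :: l => simp [step, Config.lift, PMF.pure_map, Prog.rename]
  | Prog.instr o :: l =>
    simp only [step, Config.lift, List.map_cons, Prog.rename, Instr.exec_rename ρ τ G hW h,
      PMF.map_comp]
    congr 1
    funext x
    simp [Config.lift, Instr.cost_rename]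
  | Prog.seq P Q :: l => simp [step, Config.lift, PMF.pure_map, Prog.rename]
  | Prog.ite x P Q :: l =>
    simp only [step, Config.lift, PMF.pure_map, Prog.rename, List.map_cons,
      ρ.injective.extend_apply]
    split_ifs <;> rfl
  | Prog.loop x P :: l =>
    simp only [step, Config.lift, PMF.pure_map, Prog.rename, List.map_cons,
      ρ.injective.extend_apply]
    split_ifs <;> rfl

lemma steps_lift (ρ τ : ℕ ↪ ℕ) (G : Regs) {W : QState} (hW : Avoids τ W) (h : W ≠ 0) (T : ℕ)
    (c : Config) : steps T (c.lift ρ τ G W) = (steps T c).map (Config.lift ρ τ G W) := by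
  induction T generalizing c with
  | zero => rw [steps, steps, PMF.pure_map]
  | succ T ih =>
    rw [steps, step_lift ρ τ G hW h, PMF.bind_map, steps, PMF.map_bind]
    congr 1
    funext c'
    exact ih c'

/-! ## A probabilistic relational logic for programs -/

/-- Within time `B`, the program `P` performs the experiment `μ`: its final configuration can be
coupled with the result of `μ` in such a way that they are related by `R`. -/
def Realizes {X : Type} (P : Prog) (G : Regs) (V : QState) (μ : PMF X)
    (R : X → Regs → QState → Prop) (B : ℕ) : Prop :=
  ∃ κ : PMF (X × Config), κ.map Prod.fst = μ ∧ κ.map Prod.snd = steps B ⟨[P], G, V, 0⟩ ∧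
    ∀ p ∈ κ.support, p.2.todo = [] ∧ p.2.clock ≤ B ∧ R p.1 p.2.regs p.2.mem

section Realizes

variable {X Y : Type} {P Q : Prog} {G : Regs} {V : QState} {μ : PMF X}
  {R R' : X → Regs → QState → Prop} {B B' M : ℕ}

/-- The rule of consequence. Facts that hold along every execution, namely bounded size and nonzero
memory, may be used in deriving the new postcondition. -/
lemma Realizes.weaken (h : Realizes P G V μ R B)
    (hR : ∀ x ∈ μ.support, ∀ g v, Small M G V → Small (M + B + 1) g v → (V ≠ 0 → v ≠ 0) →
      R x g v → R' x g v) (hM : Small M G V) : Realizes P G V μ R' B := by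
  obtain ⟨κ, h1, h2, h3⟩ := h
  refine ⟨κ, h1, h2, fun p hp => ⟨(h3 p hp).1, (h3 p hp).2.1, ?_⟩⟩
  have hs : p.2 ∈ (steps B ⟨[P], G, V, 0⟩).support := by
    rw [← h2, PMF.support_map]
    exact ⟨p, hp, rfl⟩
  refine hR p.1 ?_ _ _ hM ?_ ?_ (h3 p hp).2.2
  · rw [← h1, PMF.support_map]
    exact ⟨p, hp, rfl⟩
  · have := small_of_mem_steps (M := M) hM B _ hs
    exact this.mono (by have := (h3 p hp).2.1; omega)
  · exact fun hV => steps_invariant (I := fun c => c.mem ≠ 0)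
      (fun _ h => mem_ne_zero_of_mem_step h) hV B _ hs

lemma Realizes.mono (h : Realizes P G V μ R B) (hB : B ≤ B') : Realizes P G V μ R B' := by
  obtain ⟨κ, h1, h2, h3⟩ := h
  obtain ⟨m, rfl⟩ := Nat.exists_eq_add_of_le hB
  refine ⟨κ, h1, ?_, fun p hp => ⟨(h3 p hp).1, (h3 p hp).2.1.trans hB, (h3 p hp).2.2⟩⟩
  rw [steps_add_of_halted, h2]
  intro c hc
  rw [← h2, PMF.support_map] at hc
  obtain ⟨p, hp, rfl⟩ := hc
  exact (h3 p hp).1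

lemma Realizes.seq {ν : X → PMF Y} {R₂ : Y → Regs → QState → Prop} (h : Realizes P G V μ R B)
    (h' : ∀ x ∈ μ.support, ∀ g v, R x g v → Realizes Q g v (ν x) R₂ B') :
    Realizes (P.seq Q) G V (μ.bind ν) R₂ (B + B' + 1) := by
  obtain ⟨κ, h1, h2, h3⟩ := h
  -- The couplings for the second program exist only at reachable `p`. Elsewhere an arbitrary
  -- distribution is chosen, so that the couplings can be glued by `bind`.
  have hex : ∀ p : X × Config, ∃ κ₂ : PMF (Y × Config), p ∈ κ.support →
      κ₂.map Prod.fst = ν p.1 ∧ κ₂.map Prod.snd = steps B' ⟨[Q], p.2.regs, p.2.mem, 0⟩ ∧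
      ∀ q ∈ κ₂.support, q.2.todo = [] ∧ q.2.clock ≤ B' ∧ R₂ q.1 q.2.regs q.2.mem := by
    intro p
    by_cases hp : p ∈ κ.support
    · obtain ⟨κ₂, hκ₂⟩ := h' p.1
        (by rw [← h1, PMF.support_map]; exact ⟨p, hp, rfl⟩) _ _ (h3 p hp).2.2
      exact ⟨κ₂, fun _ => hκ₂⟩
    · exact ⟨(ν p.1).map fun y => (y, p.2), fun h => absurd h hp⟩
  choose κ₂ hκ₂ using hex
  have hplug : ∀ p ∈ κ.support, steps B' (p.2.plug [Q] 1) =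
      (κ₂ p).map fun q => q.2.plug [] (p.2.clock + 1) := by
    intro p hp
    have e : p.2.plug [Q] 1 =
        (⟨[Q], p.2.regs, p.2.mem, 0⟩ : Config).plug [] (p.2.clock + 1) := by
      simp [Config.plug, (h3 p hp).1]
    rw [e, steps_plug_nil, ← (hκ₂ p hp).2.1, PMF.map_comp]
    rfl
  refine ⟨κ.bind fun p => (κ₂ p).map fun q => (q.1, q.2.plug [] (p.2.clock + 1)), ?_, ?_, ?_⟩
  · rw [PMF.map_bind, ← h1, PMF.bind_map]
    refine bind_congr_of_support fun p hp => ?_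
    rw [PMF.map_comp, Function.comp_apply, ← (hκ₂ p hp).1]
    rfl
  -- The additional step unfolds `Prog.seq`.
  · have e : steps (B + B' + 1) ⟨[P.seq Q], G, V, 0⟩ =
        steps (B + B') ((⟨[P], G, V, 0⟩ : Config).plug [Q] 1) := by
      rw [steps]
      simp [step, Config.plug]
    rw [e, steps_plug]
    · rw [← h2, PMF.bind_map, PMF.map_bind]
      refine bind_congr_of_support fun p hp => ?_
      rw [Function.comp_apply, hplug p hp, PMF.map_comp]
      rfl
    · intro c hc
      rw [← h2, PMF.support_map] at hc
      obtain ⟨p, hp, rfl⟩ := hc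
      refine ⟨(h3 p hp).1, fun c' hc' => ?_⟩
      rw [hplug p hp, PMF.support_map] at hc'
      obtain ⟨q, hq, rfl⟩ := hc'
      simp [Config.plug, ((hκ₂ p hp).2.2 q hq).1]
  · intro q hq
    rw [PMF.mem_support_bind_iff] at hq
    obtain ⟨p, hp, hq⟩ := hq
    rw [PMF.support_map] at hq
    obtain ⟨q, hq, rfl⟩ := hq
    obtain ⟨h4, h5, h6⟩ := (hκ₂ p hp).2.2 q hq
    refine ⟨by simp [Config.plug, h4], ?_, h6⟩
    have := (h3 p hp).2.1
    simp only [Config.plug]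
    omega

lemma realizes_instr (o : Instr) (G : Regs) (V : QState) :
    Realizes (Prog.instr o) G V (o.exec G V) (fun s g v => g = s.1 ∧ v = s.2) (o.cost G) := by
  -- The instruction is a single step. Its cost is at least one, so the budget suffices and the
  -- remaining steps are idle.
  obtain ⟨B, hB⟩ := Nat.exists_eq_add_of_le' (o.one_le_cost G)
  refine ⟨(o.exec G V).map fun s => (s, ⟨[], s.1, s.2, o.cost G⟩), ?_, ?_, ?_⟩
  · rw [PMF.map_comp]
    exact PMF.map_id _
  · conv_rhs => rw [hB]
    rw [steps, bind_congr_of_support (g := PMF.pure), PMF.bind_pure, PMF.map_comp]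
    · simp [step, Function.comp_def]
    · intro c hc
      simp only [step, PMF.support_map] at hc
      obtain ⟨s, -, rfl⟩ := hc
      exact steps_of_halted rfl _
  · intro p hp
    rw [PMF.support_map] at hp
    obtain ⟨s, -, rfl⟩ := hp
    exact ⟨rfl, le_rfl, rfl, rfl⟩

lemma realizes_of_step {P' : Prog} (h : Realizes P G V μ R B)
    (hstep : step ⟨[P'], G, V, 0⟩ = PMF.pure ⟨[P], G, V, 1⟩) : Realizes P' G V μ R (B + 1) := by
  obtain ⟨κ, h1, h2, h3⟩ := h
  refine ⟨κ.map fun p => (p.1, p.2.plug [] 1), ?_, ?_, ?_⟩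
  · rw [PMF.map_comp, ← h1]
    rfl
  · have e : (⟨[P], G, V, 1⟩ : Config) = (⟨[P], G, V, 0⟩ : Config).plug [] 1 := rfl
    rw [steps, hstep, PMF.pure_bind, e, steps_plug_nil, ← h2, PMF.map_comp, PMF.map_comp]
    rfl
  · intro p hp
    rw [PMF.support_map] at hp
    obtain ⟨p, hp, rfl⟩ := hp
    obtain ⟨h4, h5, h6⟩ := h3 p hp
    exact ⟨by simp [Config.plug, h4], by simpa [Config.plug] using h5, h6⟩

lemma realizes_skip (G : Regs) (V : QState) :
    Realizes Prog.skip G V (PMF.pure ()) (fun _ g v => g = G ∧ v = V) 1 := by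
  refine ⟨PMF.pure ((), ⟨[], G, V, 1⟩), by simp [PMF.pure_map],
    by simp [PMF.pure_map, steps, step], ?_⟩
  intro p hp
  rw [PMF.support_pure, Set.mem_singleton_iff] at hp
  subst hp
  exact ⟨rfl, le_rfl, rfl, rfl⟩

end Realizes

/-- `P` performs the experiments `μ z`, in a time that is polynomial in the size of the
memory. -/
def Spec {Z X : Type} (P : Prog) (Pre : Z → Regs → QState → Prop) (μ : Z → PMF X)
    (Post : Z → X → Regs → QState → Prop) : Prop :=
  ∃ p : Polynomial ℕ, ∀ M z G V, Small M G V → V ≠ 0 → Pre z G V →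
    Realizes P G V (μ z) (Post z) (p.eval M)

lemma eval_mono (p : Polynomial ℕ) {a b : ℕ} (h : a ≤ b) : p.eval a ≤ p.eval b := by
  rw [Polynomial.eval_eq_sum, Polynomial.eval_eq_sum]
  exact Finset.sum_le_sum fun i _ => Nat.mul_le_mul_left _ (Nat.pow_le_pow_left h i)

section Spec

variable {Z Z' X Y : Type} {P Q : Prog} {Pre : Z → Regs → QState → Prop} {μ : Z → PMF X}
  {Post : Z → X → Regs → QState → Prop}

/-- The rule of consequence with a change of the auxiliary parameter: `z` may be chosen after the
initial memory is known, so it can record that memory. -/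
lemma Spec.adapt (h : Spec P Pre μ Post) {Pre' : Z' → Regs → QState → Prop} {μ' : Z' → PMF X}
    {Post' : Z' → X → Regs → QState → Prop}
    (h' : ∀ z' G V, V ≠ 0 → Pre' z' G V → ∃ z, Pre z G V ∧ μ' z' = μ z ∧
      ∀ x ∈ (μ z).support, ∀ g v, v ≠ 0 → Post z x g v → Post' z' x g v) : Spec P Pre' μ' Post' := by
  obtain ⟨p, hp⟩ := h
  refine ⟨p, fun M z' G V hM hV hz' => ?_⟩
  obtain ⟨z, hz, hμ, hpost⟩ := h' z' G V hV hz'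
  rw [hμ]
  exact (hp M z G V hM hV hz).weaken (fun x hx g v _ _ hv => hpost x hx g v (hv hV)) hM

lemma Spec.seq (h : Spec P Pre μ Post) {ν : Z × X → PMF Y} {Post₂ : Z → Y → Regs → QState → Prop}
    (h₂ : Spec Q (fun zx : Z × X => Post zx.1 zx.2) ν fun zx => Post₂ zx.1) :
    Spec (P.seq Q) Pre (fun z => (μ z).bind fun x => ν (z, x)) Post₂ := by
  obtain ⟨p, hp⟩ := h
  obtain ⟨q, hq⟩ := h₂
  -- When the second program starts, the memory has size at most `M + p(M) + 1`; the final `1` is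
  -- the step that unfolds the sequence.
  refine ⟨p + q.comp (Polynomial.X + p + 1) + 1, fun M z G V hM hV hz => ?_⟩
  have hP := (hp M z G V hM hV hz).weaken
    (R' := fun x g v => Post z x g v ∧ Small (M + p.eval M + 1) g v ∧ v ≠ 0)
    (fun x _ g v _ h1 h2 h3 => ⟨h3, h1, h2 hV⟩) hM
  have := hP.seq (Q := Q) (ν := fun x => ν (z, x)) (R₂ := Post₂ z)
    (fun x _ g v hx => hq _ (z, x) g v hx.2.1 hx.2.2 hx.1)
  simpa [Polynomial.eval_comp] using this

/-- The effect on the registers of a program without loops and quantum instructions. -/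
def Prog.eval : Prog → Regs → Regs
  | skip, g => g
  | instr (.clear x), g => Function.update g x Data.nil
  | instr (.copy x y), g => Function.update g x (g y)
  | instr (.cons x y z), g => Function.update g x (Data.cons (g y) (g z))
  | instr (.fst x y), g => Function.update g x (g y).fst
  | instr (.snd x y), g => Function.update g x (g y).snd
  | instr _, g => g
  | seq P Q, g => Q.eval (P.eval g)
  | ite x P Q, g => if (g x).isNil then Q.eval g else P.eval g
  | loop _ _, g => g

/-- The program has no loops and no quantum instructions. -/
def Prog.Simple : Prog → Prop
  | skip => True
  | instr (.had ..) => False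
  | instr (.phase ..) => False
  | instr (.cnot ..) => False
  | instr (.meas ..) => False
  | instr _ => True
  | seq P Q => P.Simple ∧ Q.Simple
  | ite _ P Q => P.Simple ∧ Q.Simple
  | loop _ _ => False

lemma Instr.cost_le {M : ℕ} {g : Regs} (h : ∀ r, (g r).size ≤ M) (o : Instr) :
    o.cost g ≤ 2 * M + 1 := by
  cases o with
  | clear => simp only [Instr.cost]; omega
  | cons x y z => have := h y; have := h z; simp only [Instr.cost]; omega
  | cnot r x s y => have := h x; have := h y; simp only [Instr.cost]; omega
  | copy x y => have := h y; simp only [Instr.cost]; omega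
  | fst x y => have := h y; simp only [Instr.cost]; omega
  | snd x y => have := h y; simp only [Instr.cost]; omega
  | had r x => have := h x; simp only [Instr.cost]; omega
  | phase r x => have := h x; simp only [Instr.cost]; omega
  | meas r x z => have := h x; simp only [Instr.cost]; omega

lemma spec_instr (o : Instr) :
    Spec (Prog.instr o) (fun (z : Regs × QState) G V => G = z.1 ∧ V = z.2)
      (fun z => o.exec z.1 z.2) (fun _ s G V => G = s.1 ∧ V = s.2) := by
  -- An instruction has at most two operands, each of size at most `M`.
  refine ⟨2 * Polynomial.X + 1, ?_⟩
  rintro M ⟨_, _⟩ G V hM hV ⟨rfl, rfl⟩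
  exact (realizes_instr o _ _).mono (by simpa using o.cost_le hM.1)

lemma spec_eval {P : Prog} (hP : P.Simple) :
    Spec P (fun (z : Regs × QState) G V => G = z.1 ∧ V = z.2) (fun _ => PMF.pure ())
      (fun z _ G V => G = P.eval z.1 ∧ V = z.2) := by
  induction P with
  | skip =>
    refine ⟨1, ?_⟩
    rintro M ⟨_, _⟩ G V hM hV ⟨rfl, rfl⟩
    simpa [Prog.eval] using realizes_skip G V
  | instr o =>
    obtain ⟨p, hp⟩ := spec_instr o
    refine ⟨p, ?_⟩
    rintro M ⟨_, _⟩ G V hM hV ⟨rfl, rfl⟩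
    obtain ⟨κ, h1, h2, h3⟩ := hp M (G, V) G V hM hV ⟨rfl, rfl⟩
    change _ = o.exec G V at h1
    -- The experiment is trivial, so the coupled result is forgotten; only the final configuration
    -- matters.
    refine ⟨κ.map fun p => ((), p.2), ?_, ?_, ?_⟩
    · rw [PMF.map_comp]
      exact PMF.map_const κ ()
    · rw [PMF.map_comp, ← h2]
      rfl
    · intro p hp
      rw [PMF.support_map] at hp
      obtain ⟨p, hp, rfl⟩ := hp
      obtain ⟨h4, h5, h6, h7⟩ := h3 p hp
      refine ⟨h4, h5, ?_⟩
      have hs : p.1 ∈ (o.exec G V).support := by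
        rw [← h1, PMF.support_map]
        exact ⟨p, hp, rfl⟩
      dsimp only
      rw [h6, h7]
      cases o <;> first
        | exact hP.elim
        | (simp only [Instr.exec, PMF.support_pure, Set.mem_singleton_iff] at hs
           rw [hs]
           exact ⟨rfl, rfl⟩)
  | seq P Q ihP ihQ =>
    have := (ihP hP.1).seq (ν := fun _ => PMF.pure ())
      (Post₂ := fun z _ G V => G = (P.seq Q).eval z.1 ∧ V = z.2) ((ihQ hP.2).adapt ?_)
    · simpa [PMF.pure_bind] using this
    · rintro ⟨z, _⟩ G V hV ⟨rfl, rfl⟩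
      exact ⟨(P.eval z.1, z.2), ⟨rfl, rfl⟩, rfl, fun _ _ _ _ _ h => h⟩
  | ite x P Q ihP ihQ =>
    obtain ⟨p, hp⟩ := ihP hP.1
    obtain ⟨q, hq⟩ := ihQ hP.2
    refine ⟨p + q + 1, ?_⟩
    rintro M ⟨_, _⟩ G V hM hV ⟨rfl, rfl⟩
    cases hx : (G x).isNil
    · have := hp M (G, V) G V hM hV ⟨rfl, rfl⟩
      refine ((realizes_of_step (P' := Prog.ite x P Q) this ?_).weaken (M := M) ?_ hM).mono ?_
      · simp [step, hx]
      · rintro _ _ g v - - - ⟨h1, h2⟩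
        exact ⟨by simpa [Prog.eval, hx] using h1, h2⟩
      · simp only [Polynomial.eval_add, Polynomial.eval_one]; omega
    · have := hq M (G, V) G V hM hV ⟨rfl, rfl⟩
      refine ((realizes_of_step (P' := Prog.ite x P Q) this ?_).weaken (M := M) ?_ hM).mono ?_
      · simp [step, hx]
      · rintro _ _ g v - - - ⟨h1, h2⟩
        exact ⟨by simpa [Prog.eval, hx] using h1, h2⟩
      · simp only [Polynomial.eval_add, Polynomial.eval_one]; omega
  | loop => exact hP.elim

/-- A deterministic prefix is absorbed into the precondition, and in `Spec.seq_simple` a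
deterministic suffix is absorbed into the postcondition. The experiment is unchanged in both cases.
-/
lemma Spec.simple_seq (hP : P.Simple) {Post : Z → Y → Regs → QState → Prop} {ν : Z → PMF Y}
    (h : Spec Q (fun z G V => ∃ g, Pre z g V ∧ G = P.eval g) ν Post) :
    Spec (P.seq Q) Pre ν Post := by
  have := ((spec_eval hP).adapt (Z' := Z) (Pre' := Pre) (μ' := fun _ => PMF.pure ())
    (Post' := fun z _ G V => ∃ g, Pre z g V ∧ G = P.eval g) ?_).seq
    (ν := fun zx => ν zx.1) (Post₂ := Post) (h.adapt ?_)
  · simpa [PMF.pure_bind] using this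
  · rintro z G V hV hz
    exact ⟨(G, V), ⟨rfl, rfl⟩, rfl, fun _ _ g v _ hg => ⟨G, hg.2 ▸ hz, hg.1⟩⟩
  · rintro ⟨z, _⟩ G V hV hz
    exact ⟨z, hz, rfl, fun _ _ _ _ _ h => h⟩

lemma Spec.seq_simple (hQ : Q.Simple) {Post : Z → X → Regs → QState → Prop}
    (h : Spec P Pre μ fun z x G V => Post z x (Q.eval G) V) :
    Spec (P.seq Q) Pre μ Post := by
  have := h.seq (Q := Q) (ν := fun zx => PMF.pure zx.2) (Post₂ := Post) ?_
  · simpa [PMF.bind_pure] using this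
  · obtain ⟨q, hq⟩ := spec_eval hQ
    refine ⟨q, fun M z G V hM hV hz => ?_⟩
    obtain ⟨κ, h1, h2, h3⟩ := hq M (G, V) G V hM hV ⟨rfl, rfl⟩
    refine ⟨κ.map fun p => (z.2, p.2), ?_, ?_, ?_⟩
    · rw [PMF.map_comp]
      exact PMF.map_const κ z.2
    · rw [PMF.map_comp, ← h2]
      rfl
    · intro p hp
      rw [PMF.support_map] at hp
      obtain ⟨p, hp, rfl⟩ := hp
      obtain ⟨h4, h5, h6, h7⟩ := h3 p hp
      refine ⟨h4, h5, ?_⟩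
      dsimp only at h6 h7 ⊢
      rw [h6, h7]
      exact hz

end Spec

/-! ## From programs to algorithms, and back -/

/-- The quantum inputs of an algorithm with `q` quantum inputs. -/
def ValidInput (q : ℕ) (ψ φ : QState) : Prop :=
  ψ ≠ 0 ∧ φ ≠ 0 ∧ (q < 1 → ψ = blank) ∧ (q < 2 → φ = blank)

/-- The initial contents of the registers. -/
def initRegs (n : ℕ) (x : Data) : Regs :=
  fun i => if i = 0 then Data.unary n else if i = 1 then x else Data.nil

structure Input : Type where
  n : ℕ
  x : Data
  ψ : QState
  φ : QState

/-- The initial configuration has registers `G` and memory `V`. -/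
def Input.Init (q : ℕ) (z : Input) (G : Regs) (V : QState) : Prop :=
  ValidInput q z.ψ z.φ ∧ G = initRegs z.n z.x ∧ V = tensor z.ψ z.φ

lemma size_unary (n : ℕ) : (Data.unary n).size = 2 * n + 1 := by
  induction n with
  | zero => rfl
  | succ n ih => simp only [Data.unary, Data.size, ih]; ring

lemma qlen_tensor_le (ψ φ : QState) : qlen (tensor ψ φ) ≤ qlen ψ + qlen φ := by
  rw [qlen_le_iff, tensor_eq_split]
  intro u hu ⟨r, i⟩ hc
  rw [split_apply, split_apply] at hu
  have hψ := left_ne_zero_of_mul hu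
  have hφ := left_ne_zero_of_mul (right_ne_zero_of_mul hu)
  have hb := right_ne_zero_of_mul (right_ne_zero_of_mul hu)
  have h1 := qlen_le_iff.1 (le_refl (qlen ψ)) _ hψ
  have h2 := qlen_le_iff.1 (le_refl (qlen φ)) _ hφ
  by_cases hA : ∃ a, tapesA a = r
  · obtain ⟨a, rfl⟩ := hA
    have := h1 (a, i) (mem_pre.2 hc)
    simp only at this ⊢
    omega
  · have hr : (r, i) ∈ rest tapesA u := mem_rest.2 ⟨hc, fun a ha => hA ⟨a, ha⟩⟩
    by_cases hB : ∃ a, tapesB a = r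
    · obtain ⟨a, rfl⟩ := hB
      have := h2 (a, i) (mem_pre.2 hr)
      simp only at this ⊢
      omega
    · have hr' : (r, i) ∈ rest tapesB (rest tapesA u) := mem_rest.2 ⟨hr, fun a ha => hB ⟨a, ha⟩⟩
      rw [blank_apply] at hb
      have h0 : rest tapesB (rest tapesA u) = ∅ := by
        by_contra h0
        simp [h0] at hb
      rw [h0] at hr'
      simp at hr'

lemma small_init (n : ℕ) (x : Data) (ψ φ : QState) :
    Small (2 * inputLength n x ψ φ + 1) (initRegs n x) (tensor ψ φ) := by
  have h1 := qlen_tensor_le ψ φ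
  constructor
  · intro r
    unfold initRegs inputLength
    split_ifs
    · rw [size_unary]; omega
    · omega
    · simp [Data.size]
  · unfold inputLength
    omega

/-- The postcondition makes the result of the experiment a function of the output, so the coupling
collapses to an equality of distributions. -/
lemma Spec.exists_qpt {Y : Type} {q : ℕ} {P : Prog} {μ : Input → PMF Y} (f : Data × QState → Y)
    (h : Spec P (Input.Init q) μ fun _ y G V => f (G 0, V) = y) :
    ∃ A : QPT q, ∀ n x ψ φ, ValidInput q ψ φ → (A.run n x ψ φ).map f = μ ⟨n, x, ψ, φ⟩ := by
  obtain ⟨p, hp⟩ := h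
  -- The initial memory has size at most twice the input length plus one, because the unary
  -- parameter `n` has `2 n + 1` nodes.
  have hreal : ∀ n x ψ φ, ValidInput q ψ φ →
      Realizes P (initRegs n x) (tensor ψ φ) (μ ⟨n, x, ψ, φ⟩) (fun y G V => f (G 0, V) = y)
        ((p.comp (2 * Polynomial.X + 1)).eval (inputLength n x ψ φ)) := by
    intro n x ψ φ hv
    have := hp _ ⟨n, x, ψ, φ⟩ _ _ (small_init n x ψ φ) (tensor_ne_zero hv.1 hv.2.1) ⟨hv, rfl, rfl⟩
    simpa [Polynomial.eval_comp] using this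
  have hhalts : ∀ n x ψ φ, ψ ≠ 0 → φ ≠ 0 → (q < 1 → ψ = blank) → (q < 2 → φ = blank) →
      ∀ c ∈ (steps ((p.comp (2 * Polynomial.X + 1)).eval (inputLength n x ψ φ))
        (initial P n x ψ φ)).support, c.todo = [] ∧
          c.clock ≤ (p.comp (2 * Polynomial.X + 1)).eval (inputLength n x ψ φ) := by
    intro n x ψ φ h1 h2 h3 h4 c hc
    obtain ⟨κ, -, hκ, hs⟩ := hreal n x ψ φ ⟨h1, h2, h3, h4⟩
    have hc' : c ∈ (κ.map Prod.snd).support := hκ ▸ hc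
    rw [PMF.support_map] at hc'
    obtain ⟨p, hp, rfl⟩ := hc'
    exact ⟨(hs p hp).1, (hs p hp).2.1⟩
  refine ⟨⟨P, p.comp (2 * Polynomial.X + 1), hhalts⟩, fun n x ψ φ hv => ?_⟩
  obtain ⟨κ, h1, hκ, hs⟩ := hreal n x ψ φ hv
  have e : QPT.run ⟨P, p.comp (2 * Polynomial.X + 1), hhalts⟩ n x ψ φ =
      (κ.map Prod.snd).map fun c => (c.regs 0, c.mem) := by
    rw [hκ]
    rfl
  rw [e, ← h1, PMF.map_comp, PMF.map_comp]
  refine bind_congr_of_support fun p hp => ?_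
  simp [(hs p hp).2.2]

/-- The registers of a subroutine. -/
def regBlock (j : ℕ) : ℕ ↪ ℕ := ⟨fun i => 8 * i + j, fun a b h => by simp only at h; omega⟩

@[simp] lemma regBlock_apply (j : ℕ) (i : ℕ) : regBlock j i = 8 * i + j := rfl

/-- Tapes that hold no input. -/
def tapeBlock (j : ℕ) : ℕ ↪ ℕ :=
  ⟨fun i => 3 * (8 * i + j) + 2, fun a b h => by simp only at h; omega⟩

@[simp] lemma tapeBlock_apply (j : ℕ) (i : ℕ) : tapeBlock j i = 3 * (8 * i + j) + 2 := rfl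

/-- A call of the program `P` with the registers `ρ i`, the tapes `δ r`, and the content of
register `src` as classical input. -/
def call (P : Prog) (ρ δ : ℕ ↪ ℕ) (src : ℕ) : Prog :=
  .seq (.seq (.instr (.copy (ρ 0) 0)) (.instr (.copy (ρ 1) src))) (P.rename ρ δ)

/-- The coupling is the actual run of `A`, each configuration being paired with its lifted copy;
`steps_lift` says that the copies follow the renamed program. -/
lemma realizes_rename {q : ℕ} (A : QPT q) {n : ℕ} {x : Data} {ψ φ : QState}
    (hv : ValidInput q ψ φ) {ρ δ : ℕ ↪ ℕ} {W : QState} (hW : Avoids δ W) (hW0 : W ≠ 0) {G : Regs}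
    (hG : ∀ i, G (ρ i) = initRegs n x i) :
    Realizes (A.prog.rename ρ δ) G (split δ (tensor ψ φ) W) (A.run n x ψ φ)
      (fun o g v => g (ρ 0) = o.1 ∧ (∀ r, (∀ i, ρ i ≠ r) → g r = G r) ∧ v = split δ o.2 W)
      (A.time.eval (inputLength n x ψ φ)) := by
  have hG' : G = Function.extend ρ (initRegs n x) G := by
    funext r
    by_cases hr : ∃ i, ρ i = r
    · obtain ⟨i, rfl⟩ := hr
      rw [hG, ρ.injective.extend_apply]
    · rw [Function.extend_apply' _ _ _ hr]
  refine ⟨(steps (A.time.eval (inputLength n x ψ φ)) (initial A.prog n x ψ φ)).map fun c =>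
    ((c.regs 0, c.mem), c.lift ρ δ G W), ?_, ?_, ?_⟩
  · rw [PMF.map_comp]
    rfl
  · rw [PMF.map_comp]
    have := steps_lift ρ δ G hW hW0 (A.time.eval (inputLength n x ψ φ)) (initial A.prog n x ψ φ)
    have e : (initial A.prog n x ψ φ).lift ρ δ G W =
        ⟨[A.prog.rename ρ δ], G, split δ (tensor ψ φ) W, 0⟩ := by
      conv_rhs => rw [hG']
      rfl
    rw [← e, this]
    rfl
  · intro p hp
    rw [PMF.support_map] at hp
    obtain ⟨c, hc, rfl⟩ := hp
    obtain ⟨h1, h2⟩ := A.halts n x ψ φ hv.1 hv.2.1 hv.2.2.1 hv.2.2.2 c hc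
    refine ⟨by simp [Config.lift, h1], h2, ?_, ?_, rfl⟩
    · simp [Config.lift, ρ.injective.extend_apply]
    · intro r hr
      exact Function.extend_apply' _ _ _ fun ⟨i, hi⟩ => hr i hi

/-- What a call of `A` needs: the inputs, and fresh registers and tapes. -/
structure CallPre (q : ℕ) (z : Input) (ρ δ : ℕ ↪ ℕ) (src : ℕ) (W : QState) (G : Regs)
    (V : QState) : Prop where
  valid : ValidInput q z.ψ z.φ
  param : G 0 = Data.unary z.n
  input : G src = z.x
  src_notMem : ∀ i, ρ i ≠ src
  fresh : ∀ i, G (ρ i) = Data.nil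
  mem : V = split δ (tensor z.ψ z.φ) W
  avoids : Avoids δ W
  ne_zero : W ≠ 0

/-! ### Calling an algorithm as a subroutine, in time polynomial in the caller's memory. -/

lemma qlen_le_qlen_split {δ : ℕ ↪ ℕ} {v W : QState} (hW : Avoids δ W) (hW0 : W ≠ 0) :
    qlen v ≤ qlen (split δ v W) := by
  rw [qlen_le_iff]
  intro s hs c hc
  obtain ⟨t, ht⟩ := Finsupp.support_nonempty_iff.2 hW0
  have h := qlen_le_iff.1 (le_refl (qlen (split δ v W))) (s.map (moveCell δ) ∪ t) ?_ (δ c.1, c.2) ?_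
  · exact h
  · rw [split_apply, pre_map_union (hW t ht), rest_map_union (hW t ht)]
    exact mul_ne_zero hs (by simpa using ht)
  · exact Finset.mem_union_left _ (Finset.mem_map_of_mem (moveCell δ) hc)

lemma qlen_tensor_left {ψ φ : QState} (hφ : φ ≠ 0) : qlen ψ ≤ qlen (tensor ψ φ) := by
  rw [tensor_eq_split]
  refine qlen_le_qlen_split (avoids_split (avoids_blank _) fun r t => ?_)
    (split_ne_zero (avoids_blank _) hφ blank_ne_zero)
  simp only [tapesA_apply, tapesB_apply]
  omega

lemma qlen_tensor_right {ψ φ : QState} (hψ : ψ ≠ 0) : qlen φ ≤ qlen (tensor ψ φ) := by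
  have h : ∀ r t, tapesB r ≠ tapesA t := fun r t => by
    simp only [tapesA_apply, tapesB_apply]; omega
  rw [tensor_eq_split, split_comm fun r t => (h t r).symm]
  exact qlen_le_qlen_split (avoids_split (avoids_blank _) h)
    (split_ne_zero (avoids_blank _) hψ blank_ne_zero)

lemma spec_call {q : ℕ} (A : QPT q) (ρ δ : ℕ ↪ ℕ) (src : ℕ) :
    Spec (call A.prog ρ δ src)
      (fun (z : Input × Regs × QState) G V => G = z.2.1 ∧ CallPre q z.1 ρ δ src z.2.2 G V)
      (fun z => A.run z.1.n z.1.x z.1.ψ z.1.φ)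
      (fun z o G V => G (ρ 0) = o.1 ∧ (∀ r, (∀ i, ρ i ≠ r) → G r = z.2.1 r) ∧
        V = split δ o.2 z.2.2) := by
  -- The input length of `A` is a sum of four terms, each at most `M`, hence the argument `4 X`.
  refine Spec.simple_seq (by simp [Prog.Simple]) ⟨A.time.comp (4 * Polynomial.X), ?_⟩
  rintro M ⟨⟨n, x, ψ, φ⟩, _, W⟩ _ V hM hV ⟨G₀, ⟨rfl, hz⟩, rfl⟩
  dsimp only at *
  have hρ : ρ 0 ≠ src := hz.src_notMem 0
  have h1 : ∀ r, (∀ i, ρ i ≠ r) →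
      (Prog.seq (.instr (.copy (ρ 0) 0)) (.instr (.copy (ρ 1) src))).eval G₀ r = G₀ r := by
    intro r hr
    simp only [Prog.eval]
    rw [Function.update_of_ne (hr 1).symm, Function.update_of_ne (hr 0).symm]
  have h2 : ∀ i, (Prog.seq (.instr (.copy (ρ 0) 0)) (.instr (.copy (ρ 1) src))).eval G₀ (ρ i) =
      initRegs n x i := by
    intro i
    simp only [Prog.eval]
    rw [Function.update_of_ne hρ.symm, hz.input, hz.param]
    unfold initRegs
    by_cases hi1 : i = 1
    · subst hi1; simp
    · rw [Function.update_of_ne (ρ.injective.ne hi1)]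
      by_cases hi0 : i = 0
      · subst hi0; simp
      · rw [Function.update_of_ne (ρ.injective.ne hi0), hz.fresh]
        simp [hi0, hi1]
  have := realizes_rename A hz.valid hz.avoids hz.ne_zero h2
  rw [← hz.mem] at this
  refine (this.weaken (M := M) ?_ hM).mono ?_
  · rintro o - g v - - - ⟨h3, h4, h5⟩
    exact ⟨h3, fun r hr => (h4 r hr).trans (h1 r hr), h5⟩
  · rw [Polynomial.eval_comp]
    refine eval_mono _ ?_
    have hn : 2 * n + 1 ≤ M := by
      have := hM.1 (ρ 0)
      rwa [h2, initRegs, if_pos rfl, size_unary] at this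
    have hx : x.size ≤ M := by
      have := hM.1 (ρ 1)
      rwa [h2, initRegs, if_neg one_ne_zero, if_pos rfl] at this
    have hq := hM.2
    rw [hz.mem] at hq
    have e1 := qlen_le_qlen_split (v := tensor ψ φ) hz.avoids hz.ne_zero
    have e2 := qlen_tensor_left (ψ := ψ) hz.valid.2.1
    have e3 := qlen_tensor_right (φ := φ) hz.valid.1
    dsimp only at hq e2 e3
    simp only [inputLength, Polynomial.eval_mul, Polynomial.eval_X, Polynomial.eval_ofNat]
    omega

lemma Spec.map {Z X Y : Type} {P : Prog} {Pre : Z → Regs → QState → Prop} {μ : Z → PMF X}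
    {Post : Z → X → Regs → QState → Prop} (h : Spec P Pre μ Post) (f : Z → X → Y)
    {Post' : Z → Y → Regs → QState → Prop}
    (hf : ∀ z x G V, Post z x G V → Post' z (f z x) G V) :
    Spec P Pre (fun z => (μ z).map (f z)) Post' := by
  obtain ⟨p, hp⟩ := h
  refine ⟨p, fun M z G V hM hV hz => ?_⟩
  obtain ⟨κ, h1, h2, h3⟩ := hp M z G V hM hV hz
  refine ⟨κ.map fun p => (f z p.1, p.2), ?_, ?_, ?_⟩
  · dsimp only
    rw [← h1, PMF.map_comp, PMF.map_comp]
    rfl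
  · rw [← h2, PMF.map_comp]
    rfl
  · intro p hp
    rw [PMF.support_map] at hp
    obtain ⟨p, hp, rfl⟩ := hp
    exact ⟨(h3 p hp).1, (h3 p hp).2.1, hf _ _ _ _ (h3 p hp).2.2⟩

/-! ## Classical subroutines -/

/-- The classical output on a classical input. -/
def QPT.out (A : QPT 0) (n : ℕ) (x : Data) : PMF Data := (A.run n x blank blank).map Prod.fst

lemma validInput_blank (q : ℕ) : ValidInput q blank blank :=
  ⟨blank_ne_zero, blank_ne_zero, fun _ => rfl, fun _ => rfl⟩

/-- The registers of the blocks `J, …, 7`, and register `16`, are empty. -/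
structure Clean (J n : ℕ) (G : Regs) : Prop where
  param : G 0 = Data.unary n
  nil : G 16 = Data.nil
  fresh : ∀ r, J ≤ r % 8 → G r = Data.nil

/-- A call on block `J` can soil only registers congruent to `J` modulo `8`. Successive calls use
increasing `J`, so each finds fresh registers; those congruent to `0` remain available for the
caller's own data. -/
lemma Clean.frame {J n : ℕ} {G g : Regs} (h : Clean J n G) (hJ : 2 ≤ J) (hJ' : J < 8)
    (hg : ∀ r, (∀ i, regBlock J i ≠ r) → g r = G r) : Clean (J + 1) n g := by
  have hr : ∀ r, r % 8 ≠ J → g r = G r := by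
    intro r hr
    refine hg r fun i hi => hr ?_
    rw [regBlock_apply] at hi
    omega
  refine ⟨?_, ?_, fun r hJr => ?_⟩
  · rw [hr 0 (by omega), h.param]
  · rw [hr 16 (by omega), h.nil]
  · rw [hr r (by omega), h.fresh r (by omega)]

/-- All tapes `tapeBlock j r` with `J ≤ j < 8` are blank. -/
def Blank (J : ℕ) (V : QState) : Prop := ∀ j, J ≤ j → j < 8 → Avoids (tapeBlock j) V

lemma Blank.mono {J J' : ℕ} {V : QState} (h : Blank J V) (hJ : J ≤ J') : Blank J' V :=
  fun j hj => h j (hJ.trans hj)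

lemma Blank.split_of_disjoint {J : ℕ} {V : QState} (h : Blank J V) {τ : ℕ ↪ ℕ} (v : QState)
    (hτ : ∀ j, J ≤ j → j < 8 → ∀ r t, tapeBlock j r ≠ τ t) : Blank J (split τ v V) :=
  fun j hj hj' => avoids_split (h j hj hj') (hτ j hj hj')

lemma tapeBlock_ne {i j : ℕ} (hij : i ≠ j) (hi : i < 8) (hj : j < 8) (r t : ℕ) :
    tapeBlock i r ≠ tapeBlock j t := by
  simp only [tapeBlock_apply]
  omega

lemma tapeBlock_ne_tapesA (j r t : ℕ) : tapeBlock j r ≠ tapesA t := by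
  simp only [tapeBlock_apply, tapesA_apply]
  omega

lemma Blank.split_tapeBlock {J : ℕ} {V : QState} (h : Blank J V) (hJ : J < 8) (v : QState) :
    Blank (J + 1) (split (tapeBlock J) v V) :=
  (h.mono (Nat.le_succ J)).split_of_disjoint v fun j hj hj' => tapeBlock_ne (by omega) hj' hJ

lemma blank_blank (J : ℕ) : Blank J QCrypto.blank := fun _ _ _ => avoids_blank _

lemma Input.Init.clean {q : ℕ} {z : Input} {G : Regs} {V : QState} (h : z.Init q G V) :
    Clean 2 z.n G := by
  obtain ⟨-, rfl, -⟩ := h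
  refine ⟨by simp [initRegs], by simp [initRegs], fun r hr => ?_⟩
  have h0 : r ≠ 0 := by omega
  have h1 : r ≠ 1 := by omega
  simp [initRegs, h0, h1]

lemma Input.Init.input {q : ℕ} {z : Input} {G : Regs} {V : QState} (h : z.Init q G V) :
    G 1 = z.x := by
  obtain ⟨-, rfl, -⟩ := h
  simp [initRegs]

lemma Input.Init.mem_zero {z : Input} {G : Regs} {V : QState} (h : z.Init 0 G V) :
    V = QCrypto.blank := by
  obtain ⟨⟨-, -, h1, h2⟩, -, rfl⟩ := h
  rw [h1 (by norm_num), h2 (by norm_num), tensor_blank_blank]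

lemma spec_call_zero (A : QPT 0) {J : ℕ} (hJ : 2 ≤ J) (hJ' : J < 8) (src : ℕ) :
    Spec (call A.prog (regBlock J) (tapeBlock J) src)
      (fun (z : (ℕ × Data) × Regs × QState) G V => G = z.2.1 ∧ V = z.2.2 ∧ Clean J z.1.1 G ∧
        Blank J V ∧ G src = z.1.2 ∧ src % 8 ≠ J)
      (fun z => A.run z.1.1 z.1.2 QCrypto.blank QCrypto.blank)
      (fun z o G V => G J = o.1 ∧ (∀ r, r % 8 ≠ J → G r = z.2.1 r) ∧ Clean (J + 1) z.1.1 G ∧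
        Blank (J + 1) V ∧ V = split (tapeBlock J) o.2 z.2.2) := by
  refine (spec_call A (regBlock J) (tapeBlock J) src).adapt ?_
  rintro ⟨⟨n, x⟩, _, _⟩ G V hV ⟨rfl, rfl, hG, hb, hx, hsrc⟩
  dsimp only at *
  refine ⟨(⟨n, x, QCrypto.blank, QCrypto.blank⟩, G, V), ⟨rfl, ?_⟩, rfl, ?_⟩
  · refine ⟨validInput_blank 0, hG.param, hx, fun i hi => hsrc ?_, fun i => hG.fresh _ ?_, ?_,
      hb J le_rfl hJ', hV⟩
    · rw [regBlock_apply] at hi; omega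
    · rw [regBlock_apply]; omega
    · rw [tensor_blank_blank]
      exact (hb J le_rfl hJ').eq_split
  · rintro o - g v - ⟨h1, h2, rfl⟩
    refine ⟨by simpa using h1, fun r hr => h2 r fun i hi => hr ?_, hG.frame hJ hJ' h2,
      hb.split_tapeBlock hJ' _, rfl⟩
    rw [regBlock_apply] at hi
    omega

/-- The calls use disjoint blocks of registers and tapes, so their outputs are independent for a
given input. -/
lemma exists_out_pair (A B : QPT 0) : ∃ C : QPT 0, ∀ n x,
    C.out n x = (A.out n x).bind fun a => (B.out n x).map fun b => Data.cons a b := by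
  have hA : Spec (call A.prog (regBlock 2) (tapeBlock 2) 1) (Input.Init 0)
      (fun z => A.run z.n z.x QCrypto.blank QCrypto.blank)
      (fun z a G V => G 1 = z.x ∧ G 2 = a.1 ∧ Clean 3 z.n G ∧ Blank 3 V) := by
    refine (spec_call_zero A le_rfl (by norm_num) 1).adapt fun z G V hV hz => ?_
    refine ⟨((z.n, z.x), G, V), ⟨rfl, rfl, hz.clean, ?_, hz.input, by norm_num⟩, rfl, ?_⟩
    · rw [hz.mem_zero]
      exact blank_blank 2
    · rintro a - g v - ⟨h1, h2, h3, h4, -⟩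
      exact ⟨(h2 1 (by norm_num)).trans hz.input, h1, h3, h4⟩
  have hB : Spec (call B.prog (regBlock 3) (tapeBlock 3) 1)
      (fun (w : Input × Data × QState) G V => G 1 = w.1.x ∧ G 2 = w.2.1 ∧ Clean 3 w.1.n G ∧
        Blank 3 V)
      (fun w => B.run w.1.n w.1.x QCrypto.blank QCrypto.blank)
      (fun w b G V => Data.cons (G 2) (G 3) = Data.cons w.2.1 b.1) := by
    refine (spec_call_zero B (J := 3) (by norm_num) (by norm_num) 1).adapt
      fun w G V hV hw => ?_
    refine ⟨((w.1.n, w.1.x), G, V), ⟨rfl, rfl, hw.2.2.1, hw.2.2.2, hw.1, by norm_num⟩, rfl, ?_⟩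
    rintro b - g v - ⟨h1, h2, -⟩
    rw [h1, h2 2 (by norm_num)]
    exact congrArg (Data.cons · b.1) hw.2.1
  have hB' := hB.map (fun w b => Data.cons w.2.1 b.1)
    (Post' := fun _ y G V => Data.cons (G 2) (G 3) = y) fun _ _ _ _ h => h
  have hC := hA.seq (Q := .seq _ (.instr (.cons 0 2 3))) (Post₂ := fun _ y G V => G 0 = y)
    (Spec.seq_simple (by trivial) (by simpa [Prog.eval] using hB'))
  obtain ⟨C, hC⟩ := hC.exists_qpt Prod.fst
  refine ⟨C, fun n x => ?_⟩
  rw [QPT.out, hC _ _ _ _ (validInput_blank 0), QPT.out, QPT.out, PMF.bind_map]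
  congr 1
  funext a
  rw [Function.comp_apply, PMF.map_comp]
  rfl

lemma exists_out_comp (A B : QPT 0) : ∃ C : QPT 0, ∀ n x,
    C.out n x = (A.out n x).bind fun a => B.out n a := by
  have hA : Spec (call A.prog (regBlock 2) (tapeBlock 2) 1) (Input.Init 0)
      (fun z => A.run z.n z.x QCrypto.blank QCrypto.blank)
      (fun z a G V => G 2 = a.1 ∧ Clean 3 z.n G ∧ Blank 3 V) := by
    refine (spec_call_zero A le_rfl (by norm_num) 1).adapt fun z G V hV hz => ?_
    refine ⟨((z.n, z.x), G, V), ⟨rfl, rfl, hz.clean, ?_, hz.input, by norm_num⟩, rfl, ?_⟩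
    · rw [hz.mem_zero]
      exact blank_blank 2
    · rintro a - g v - ⟨h1, h2, h3, h4, -⟩
      exact ⟨h1, h3, h4⟩
  have hB : Spec (call B.prog (regBlock 3) (tapeBlock 3) 2)
      (fun (w : Input × Data × QState) G V => G 2 = w.2.1 ∧ Clean 3 w.1.n G ∧ Blank 3 V)
      (fun w => B.run w.1.n w.2.1 QCrypto.blank QCrypto.blank)
      (fun w b G V => G 3 = b.1) := by
    refine (spec_call_zero B (J := 3) (by norm_num) (by norm_num) 2).adapt
      fun w G V hV hw => ?_
    refine ⟨((w.1.n, w.2.1), G, V), ⟨rfl, rfl, hw.2.1, hw.2.2, hw.1, by norm_num⟩, rfl, ?_⟩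
    rintro b - g v - ⟨h1, h2, -⟩
    exact h1
  have hB' := hB.map (fun w b => b.1) (Post' := fun _ y G V => G 3 = y) fun _ _ _ _ h => h
  have hC := hA.seq (Q := .seq _ (.instr (.copy 0 3))) (Post₂ := fun _ y G V => G 0 = y)
    (Spec.seq_simple (by trivial) (by simpa [Prog.eval] using hB'))
  obtain ⟨C, hC⟩ := hC.exists_qpt Prod.fst
  refine ⟨C, fun n x => ?_⟩
  rw [QPT.out, hC _ _ _ _ (validInput_blank 0), QPT.out, PMF.bind_map]
  rfl

lemma exists_out_simple {P : Prog} (hP : P.Simple) : ∃ C : QPT 0, ∀ n x,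
    C.out n x = PMF.pure (P.eval (initRegs n x) 0) := by
  have h : Spec P (Input.Init 0) (fun z => PMF.pure ())
      (fun z _ G V => G 0 = P.eval (initRegs z.n z.x) 0) := by
    refine (spec_eval hP).adapt fun z G V hV hz => ?_
    refine ⟨(G, V), ⟨rfl, rfl⟩, rfl, ?_⟩
    rintro _ - g v - ⟨rfl, rfl⟩
    rw [hz.2.1]
  obtain ⟨C, hC⟩ := (h.map (fun z _ => P.eval (initRegs z.n z.x) 0)
    (Post' := fun _ y G V => G 0 = y) fun _ _ _ _ h => h).exists_qpt Prod.fst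
  refine ⟨C, fun n x => ?_⟩
  rw [QPT.out, hC _ _ _ _ (validInput_blank 0), PMF.pure_map]

/-- A fair coin. -/
def coin : PMF Bool := PMF.uniformOfFintype Bool

/-! ### A fair coin from a Hadamard gate. -/

lemma applyGate_gateH_blank :
    applyGate gateH (0, 0) blank =
      Finsupp.single ∅ (1 / (Real.sqrt 2 : ℂ)) + Finsupp.single {(0, 0)} (1 / (Real.sqrt 2 : ℂ)) := by
  unfold applyGate blank
  rw [Finsupp.sum_single_index (by simp)]
  simp [setBit, gateH, add_comm]

lemma sqNorm_single (s : Finset Cell) (a : ℂ) : sqNorm (Finsupp.single s a) = ‖a‖₊ ^ 2 := by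
  unfold sqNorm
  exact Finsupp.sum_single_index (by simp)

lemma sqNorm_add {v w : QState} (h : Disjoint v.support w.support) :
    sqNorm (v + w) = sqNorm v + sqNorm w :=
  Finsupp.sum_add_index_of_disjoint h _

/-- Both amplitudes are `1 / √2`, so each outcome carries half of the squared norm. -/
lemma outcome_gateH_blank : outcome (0, 0) (applyGate gateH (0, 0) blank) = coin := by
  have h2 : ‖(1 / (Real.sqrt 2 : ℂ))‖₊ ^ 2 = 1 / 2 := by
    ext
    push_cast
    rw [norm_div, norm_one, Complex.norm_real, Real.norm_eq_abs, div_pow, sq_abs,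
      Real.sq_sqrt (by norm_num)]
    norm_num
  have hp : probOne (0, 0) (applyGate gateH (0, 0) blank) = 1 / 2 := by
    have e : project (0, 0) true (applyGate gateH (0, 0) blank) =
        Finsupp.single {(0, 0)} (1 / (Real.sqrt 2 : ℂ)) := by
      rw [applyGate_gateH_blank, project, Finsupp.filter_add, Finsupp.filter_single_of_neg,
        Finsupp.filter_single_of_pos, zero_add]
      · simp
      · simp
    rw [probOne, e, applyGate_gateH_blank, sqNorm_add, sqNorm_single, sqNorm_single, h2]
    · norm_num
    · exact Disjoint.mono Finsupp.support_single_subset Finsupp.support_single_subset (by simp)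
  ext b
  have hc : coin b = 2⁻¹ := by simp [coin]
  rw [hc]
  cases b
  · rw [outcome_apply_false, hp]
    simp
  · rw [outcome_apply_true, hp]
    simp

lemma exists_out_coin : ∃ C : QPT 0, ∀ n x, C.out n x = coin.map Data.ofBool := by
  -- Register `2` is initially `nil`, of length zero, so it addresses qubit `(0, 0)`.
  have h1 : Spec (.instr (.had 0 2)) (Input.Init 0)
      (fun z => PMF.pure (initRegs z.n z.x, applyGate gateH (0, 0) QCrypto.blank))
      (fun z s G V => G = initRegs z.n z.x ∧ V = applyGate gateH (0, 0) QCrypto.blank) := by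
    refine (spec_instr (.had 0 2)).adapt fun z G V hV hz => ?_
    have e : (Instr.had 0 2).exec G V =
        PMF.pure (initRegs z.n z.x, applyGate gateH (0, 0) QCrypto.blank) := by
      rw [hz.mem_zero, hz.2.1]
      simp [Instr.exec, initRegs, Data.length]
    refine ⟨(G, V), ⟨rfl, rfl⟩, e.symm, ?_⟩
    rintro s hs g v - ⟨rfl, rfl⟩
    dsimp only at hs
    rw [e, PMF.support_pure, Set.mem_singleton_iff] at hs
    rw [hs]
    exact ⟨rfl, rfl⟩
  have h2 : Spec (.instr (.meas 0 2 0))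
      (fun (z : Input × Regs × QState) G V => G = initRegs z.1.n z.1.x ∧
        V = applyGate gateH (0, 0) QCrypto.blank)
      (fun z => (Instr.meas 0 2 0).exec (initRegs z.1.n z.1.x)
        (applyGate gateH (0, 0) QCrypto.blank))
      (fun z s G V => G 0 = s.1 0) := by
    refine (spec_instr (.meas 0 2 0)).adapt fun z G V hV hz => ?_
    refine ⟨(G, V), ⟨rfl, rfl⟩, by rw [hz.1, hz.2], ?_⟩
    rintro s - g v - ⟨rfl, rfl⟩
    rfl
  obtain ⟨C, hC⟩ := (h1.seq (Post₂ := fun _ y G V => G 0 = y) (h2.map (fun _ s => s.1 0)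
    (Post' := fun _ y G V => G 0 = y) fun _ _ _ _ h => h)).exists_qpt Prod.fst
  refine ⟨C, fun n x => ?_⟩
  rw [QPT.out, hC _ _ _ _ (validInput_blank 0), PMF.pure_bind, ← outcome_gateH_blank]
  simp only [Instr.exec, PMF.map_comp, Function.comp_def, Function.update_self]
  simp [initRegs, Data.length]

/-! ## Key generation -/

/-- Entrywise pairing of the two pairs in registers `2` and `3`. -/
def zipProg : Prog :=
  .seq (.instr (.fst 2 1)) <| .seq (.instr (.snd 3 1)) <|
  .seq (.instr (.fst 4 2)) <| .seq (.instr (.fst 5 3)) <| .seq (.instr (.cons 4 4 5)) <|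
  .seq (.instr (.snd 5 2)) <| .seq (.instr (.snd 6 3)) <| .seq (.instr (.cons 5 5 6)) <|
  .instr (.cons 0 4 5)

/-- A tree of depth `k + 1` pairs two independent trees of depth `k`, after regrouping the secret
and the public parts. The program grows with `k` and not with the security parameter. -/
lemma exists_keyTrees (S : TwoTier) (k : ℕ) : ∃ K : QPT 0, ∀ n,
    (K.out n Data.nil).map (fun d => (d.fst, d.snd)) = keyTrees S n k := by
  induction k with
  | zero =>
    refine ⟨S.keyGen, fun n => ?_⟩
    rw [QPT.out, PMF.map_comp]
    rfl
  | succ k ih =>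
    obtain ⟨K, hK⟩ := ih
    obtain ⟨D, hD⟩ := exists_out_pair K K
    obtain ⟨Z, hZ⟩ := exists_out_simple (P := zipProg) (by simp [zipProg, Prog.Simple])
    obtain ⟨C, hC⟩ := exists_out_comp D Z
    refine ⟨C, fun n => ?_⟩
    have hZ' : ∀ x, Z.out n x = PMF.pure (Data.cons (Data.cons x.fst.fst x.snd.fst)
        (Data.cons x.fst.snd x.snd.snd)) := by
      intro x
      rw [hZ]
      simp [zipProg, Prog.eval, initRegs]
    have e : keyTrees S n (k + 1) = (keyTrees S n k).bind fun a => (keyTrees S n k).bind fun b =>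
      PMF.pure (Data.cons a.1 b.1, Data.cons a.2 b.2) := rfl
    rw [e, ← hK, hC, hD]
    simp only [hZ', PMF.map_bind, PMF.bind_map, PMF.bind_bind, PMF.pure_map, Function.comp_def,
      Data.fst, Data.snd]

/-- A uniformly random bit string `l` of length `k`, and a tree of independent public keys with
the given key `pk` at position `l`. -/
def plant (S : TwoTier) (n : ℕ) (pk : Data) : ℕ → PMF (List Bool × Data)
  | 0 => PMF.pure ([], pk)
  | k + 1 => (plant S n pk k).bind fun a => (keyTrees S n k).bind fun b => coin.map fun c =>
      (c :: a.1, if c then Data.cons b.2 a.2 else Data.cons a.2 b.2)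

/-- Given `((t, (sk, pk)), c)`, the pair of `t` and `pk` in the order given by the bit `c`. -/
def orderProg : Prog :=
  .seq (.instr (.fst 2 1)) <| .seq (.instr (.snd 3 1)) <|
  .seq (.instr (.fst 4 2)) <| .seq (.instr (.snd 5 2)) <| .seq (.instr (.snd 5 5)) <|
  .ite 3 (.instr (.cons 0 5 4)) (.instr (.cons 0 4 5))

lemma exists_plant (S : TwoTier) (k : ℕ) : ∃ K : QPT 0, ∀ n pk,
    K.out n pk = (plant S n pk k).map Prod.snd := by
  induction k with
  | zero =>
    obtain ⟨C, hC⟩ := exists_out_simple (P := .instr (.copy 0 1)) trivial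
    refine ⟨C, fun n pk => ?_⟩
    rw [hC]
    simp [plant, PMF.pure_map, Prog.eval, initRegs]
  | succ k ih =>
    obtain ⟨A, hA⟩ := ih
    obtain ⟨K, hK⟩ := exists_keyTrees S k
    -- Pairing feeds the same input to both algorithms, whereas key generation expects `nil`; `N`
    -- erases the input first.
    obtain ⟨N, hN⟩ := exists_out_simple (P := .instr (.clear 0)) trivial
    obtain ⟨K', hK'⟩ := exists_out_comp N K
    obtain ⟨F, hF⟩ := exists_out_coin
    obtain ⟨D, hD⟩ := exists_out_pair A K'
    obtain ⟨D', hD'⟩ := exists_out_pair D F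
    obtain ⟨Z, hZ⟩ := exists_out_simple (P := orderProg) (by simp [orderProg, Prog.Simple])
    obtain ⟨C, hC⟩ := exists_out_comp D' Z
    refine ⟨C, fun n pk => ?_⟩
    have hZ' : ∀ (x : Data) (c : Bool), Z.out n (Data.cons x (Data.ofBool c)) = PMF.pure
        (if c then Data.cons x.snd.snd x.fst else Data.cons x.fst x.snd.snd) := by
      intro x c
      rw [hZ]
      cases c <;> simp [orderProg, Prog.eval, initRegs, Data.ofBool, Data.fst, Data.snd, Data.isNil]
    have hN' : ∀ x, K'.out n x = K.out n Data.nil := by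
      intro x
      rw [hK', hN, PMF.pure_bind]
      simp [Prog.eval]
    rw [hC, hD']
    simp only [hD, hF, plant, ← hK, hN', hA, PMF.map_bind, PMF.bind_map, PMF.bind_bind,
      PMF.map_comp, Function.comp_def, Data.fst, Data.snd, hZ']
    rfl

/-! ## Signing -/

/-- Replace the tree in register `8` by its component at the position given in register `24`. -/
def selectProg : ℕ → Prog
  | 0 => .skip
  | k + 1 => .seq (.seq (.instr (.fst 32 24)) <|
      .seq (.ite 32 (.instr (.snd 8 8)) (.instr (.fst 8 8))) (.instr (.snd 24 24))) (selectProg k)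

lemma simple_selectProg (k : ℕ) : (selectProg k).Simple := by
  induction k with
  | zero => trivial
  | succ k ih => simp [selectProg, Prog.Simple, ih]

lemma eval_selectProg (l : List Bool) {g : Regs} (h : g 24 = Data.ofBits l) :
    (selectProg l.length).eval g 8 = select l (g 8) := by
  induction l generalizing g with
  | nil => rfl
  | cons b l ih =>
    simp only [List.length_cons, selectProg, Prog.eval]
    rw [ih]
    · cases b <;> simp [select, h, Data.ofBits, Data.ofBool, Data.fst, Data.isNil]
    · cases b <;> simp [h, Data.ofBits, Data.ofBool, Data.fst, Data.snd, Data.isNil]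

lemma eval_selectProg_of_ne (k : ℕ) (g : Regs) {r : ℕ} (h8 : r ≠ 8) (h24 : r ≠ 24)
    (h32 : r ≠ 32) : (selectProg k).eval g r = g r := by
  induction k generalizing g with
  | zero => rfl
  | succ k ih =>
    simp only [selectProg, Prog.eval]
    rw [ih]
    cases hx : (g 24).fst.isNil <;> simp [h8, h24, h32, hx]

/-- Given `(d, m)`, put the component of `d` at position `m` into register `8`. -/
def selectInput (k : ℕ) : Prog :=
  .seq (.seq (.instr (.fst 8 1)) (.instr (.snd 24 1))) (selectProg k)

lemma simple_selectInput (k : ℕ) : (selectInput k).Simple := by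
  simp [selectInput, Prog.Simple, simple_selectProg]

lemma eval_selectInput (l : List Bool) {g : Regs} {d : Data}
    (h : g 1 = Data.cons d (Data.ofBits l)) :
    (selectInput l.length).eval g 8 = select l d := by
  simp only [selectInput, Prog.eval]
  rw [eval_selectProg]
  · simp [h, Data.fst]
  · simp [h, Data.snd]

lemma eval_selectInput_of_ne (k : ℕ) (g : Regs) {r : ℕ} (h8 : r ≠ 8) (h24 : r ≠ 24)
    (h32 : r ≠ 32) : (selectInput k).eval g r = g r := by
  simp only [selectInput, Prog.eval]
  rw [eval_selectProg_of_ne k _ h8 h24 h32]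
  simp [h8, h24]

lemma clean_selectInput (k : ℕ) {n : ℕ} {g : Regs} (h : Clean 2 n g) :
    Clean 2 n ((selectInput k).eval g) := by
  refine ⟨?_, ?_, fun r hr => ?_⟩
  · rw [eval_selectInput_of_ne k g (by norm_num) (by norm_num) (by norm_num), h.param]
  · rw [eval_selectInput_of_ne k g (by norm_num) (by norm_num) (by norm_num), h.nil]
  · rw [eval_selectInput_of_ne k g (by omega) (by omega) (by omega), h.fresh r hr]

/-- The component that `selectInput k` selects. -/
def selected (k n : ℕ) (x : Data) : Data := (selectInput k).eval (initRegs n x) 8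

lemma selected_cons (l : List Bool) (n : ℕ) (d : Data) :
    selected l.length n (Data.cons d (Data.ofBits l)) = select l d :=
  eval_selectInput l (by simp [initRegs])

/-- Select a key, and run a program on it with its output as the quantum output. -/
lemma exists_select_run (A : QPT 0) (k : ℕ) : ∃ C : QPT 0, ∀ n x,
    C.run n x blank blank = (A.run n (selected k n x) blank blank).map fun o =>
      (selected k n x, o.2) := by
  -- The tapes are not renamed: the memory left by `A` is the signature itself and must be output in
  -- place.
  have h : Spec (call A.prog (regBlock 2) (Function.Embedding.refl ℕ) 8)
      (fun (z : Input) G V => ∃ g, z.Init 0 g V ∧ G = (selectInput k).eval g)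
      (fun z => A.run z.n (selected k z.n z.x) blank blank)
      (fun z o G V => (G 8, V) = (selected k z.n z.x, o.2)) := by
    refine (spec_call A _ _ _).adapt ?_
    rintro z _ V hV ⟨g, hg, rfl⟩
    have hc := clean_selectInput k hg.clean
    have h8 : (selectInput k).eval g 8 = selected k z.n z.x := by rw [hg.2.1, selected]
    refine ⟨(⟨z.n, selected k z.n z.x, blank, blank⟩, (selectInput k).eval g, blank),
      ⟨rfl, ?_⟩, rfl, ?_⟩
    · refine ⟨validInput_blank 0, hc.param, h8, fun i hi => ?_, fun i => hc.fresh _ ?_, ?_,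
        avoids_blank _, blank_ne_zero⟩
      · rw [regBlock_apply] at hi; omega
      · rw [regBlock_apply]; omega
      · rw [split_refl, tensor_blank_blank, hg.mem_zero]
    · rintro o - g' v - ⟨-, h2, h3⟩
      rw [h3, split_refl, h2 8, ← h8]
      intro i hi
      rw [regBlock_apply] at hi
      omega
  have h' := h.map (fun z o => (selected k z.n z.x, o.2)) (Post' := fun _ y G V => (G 8, V) = y)
    fun _ _ _ _ h => h
  have h'' := Spec.simple_seq (simple_selectInput k) (Spec.seq_simple (Q := .instr (.copy 0 8))
    (Post := fun _ y G V => id (G 0, V) = y) trivial (by simpa [Prog.eval] using h'))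
  obtain ⟨C, hC⟩ := h''.exists_qpt
  refine ⟨C, fun n x => ?_⟩
  have := hC n x blank blank (validInput_blank 0)
  rwa [PMF.map_id] at this

/-! ## Verification and deletion -/

lemma Input.Init.mem_one {z : Input} {G : Regs} {V : QState} (h : z.Init 1 G V) :
    V = split tapesA z.ψ QCrypto.blank := by
  obtain ⟨⟨-, -, -, h2⟩, -, rfl⟩ := h
  rw [h2 (by norm_num), tensor_blank]

lemma blank_split_tapesA (ψ : QState) : Blank 0 (split tapesA ψ QCrypto.blank) :=
  (blank_blank 0).split_of_disjoint ψ fun j _ _ => tapeBlock_ne_tapesA j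

/-- Tapes for a call with one quantum input, which is on the tapes `α r`. -/
def mixBlocks (α : ℕ ↪ ℕ) (i j : ℕ) (hi : i < 8) (hj : j < 8) (hij : i ≠ j)
    (h₁ : ∀ r t, α r ≠ tapeBlock i t) (h₂ : ∀ r t, α r ≠ tapeBlock j t) : ℕ ↪ ℕ :=
  mix α (tapeBlock i) (tapeBlock j) h₁ h₂ (tapeBlock_ne hij hi hj)

lemma split_eq_split_mixBlocks {α : ℕ ↪ ℕ} {i j : ℕ} (hi : i < 8) (hj : j < 8) (hij : i ≠ j)
    (h₁ : ∀ r t, α r ≠ tapeBlock i t) (h₂ : ∀ r t, α r ≠ tapeBlock j t) {W : QState}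
    (hWi : Avoids (tapeBlock i) W) (hWj : Avoids (tapeBlock j) W) (ψ : QState) :
    split α ψ W = split (mixBlocks α i j hi hj hij h₁ h₂) (tensor ψ QCrypto.blank) W := by
  rw [mixBlocks, ← split_split_eq_split_tensor h₁ h₂ (tapeBlock_ne hij hi hj) hWj, ← hWi.eq_split]

lemma Clean.mono {J J' n : ℕ} {G : Regs} (h : Clean J n G) (hJ : J ≤ J') : Clean J' n G :=
  ⟨h.param, h.nil, fun r hr => h.fresh r (hJ.trans hr)⟩

lemma ne_zero_of_split_ne_zero {τ : ℕ ↪ ℕ} {v W : QState} (h : split τ v W ≠ 0) :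
    v ≠ 0 ∧ W ≠ 0 := by
  constructor
  · rintro rfl
    exact h (by ext; simp [split_apply])
  · rintro rfl
    exact h (by ext; simp [split_apply])

lemma validInput_one {ψ : QState} (hψ : ψ ≠ 0) : ValidInput 1 ψ QCrypto.blank :=
  ⟨hψ, blank_ne_zero, fun h => absurd h (by norm_num), fun _ => rfl⟩

lemma avoids_mix {α β γ : ℕ ↪ ℕ} (h₁ : ∀ r t, α r ≠ β t) (h₂ : ∀ r t, α r ≠ γ t)
    (h₃ : ∀ r t, β r ≠ γ t) {W : QState} (hα : Avoids α W) (hβ : Avoids β W) (hγ : Avoids γ W) :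
    Avoids (mix α β γ h₁ h₂ h₃) W := by
  intro u hu c hc r hr
  obtain ⟨s, hs⟩ | ⟨s, hs⟩ | ⟨s, hs⟩ := mix_cases h₁ h₂ h₃ r
  · exact hα u hu c hc s (hs.symm.trans hr)
  · exact hβ u hu c hc s (hs.symm.trans hr)
  · exact hγ u hu c hc s (hs.symm.trans hr)

/-- Two blocks of tapes are consumed: block `J` provides the missing second input, block `J + 1` the
work tapes. Only the blankness of later blocks is recorded about the final memory, as the quantum
output is not used again. -/
lemma spec_call_one (A : QPT 1) {α : ℕ ↪ ℕ} {J : ℕ} (hJ : 2 ≤ J) (hJ' : J < 7) (src : ℕ)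
    (hα : ∀ j, J ≤ j → j < 8 → ∀ r t, α r ≠ tapeBlock j t) :
    Spec (call A.prog (regBlock J) (mixBlocks α J (J + 1) (by omega) (by omega) (by omega)
        (hα J le_rfl (by omega)) (hα (J + 1) (by omega) (by omega))) src)
      (fun (z : (ℕ × Data × QState) × Regs × QState) G V => G = z.2.1 ∧ Clean J z.1.1 G ∧
        G src = z.1.2.1 ∧ src % 8 ≠ J ∧ z.2.2 ≠ 0 ∧ Avoids α z.2.2 ∧
        Blank J z.2.2 ∧ z.1.2.2 ≠ 0 ∧
        V = split α z.1.2.2 z.2.2)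
      (fun z => A.run z.1.1 z.1.2.1 z.1.2.2 QCrypto.blank)
      (fun z o G V => G J = o.1 ∧ (∀ r, r % 8 ≠ J → G r = z.2.1 r) ∧ Clean (J + 1) z.1.1 G ∧
        Blank (J + 2) V) := by
  refine (spec_call A (regBlock J) _ src).adapt ?_
  rintro ⟨⟨n, x, ψ⟩, _, W⟩ G _ hV ⟨rfl, hG, hx, hsrc, hW, hWα, hb, hψ, rfl⟩
  dsimp only at *
  have h₁ := hα J le_rfl (by omega)
  have h₂ := hα (J + 1) (by omega) (by omega)
  refine ⟨(⟨n, x, ψ, QCrypto.blank⟩, G, W), ⟨rfl, ?_⟩, rfl, ?_⟩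
  · refine ⟨validInput_one hψ, hG.param, hx, fun i hi => hsrc ?_, fun i => hG.fresh _ ?_, ?_, ?_, hW⟩
    · rw [regBlock_apply] at hi; omega
    · rw [regBlock_apply]; omega
    · exact split_eq_split_mixBlocks _ _ _ h₁ h₂ (hb J le_rfl (by omega))
        (hb (J + 1) (by omega) (by omega)) ψ
    · exact avoids_mix h₁ h₂ _ hWα (hb J le_rfl (by omega)) (hb (J + 1) (by omega) (by omega))
  · rintro o - g v - ⟨h1, h2, rfl⟩
    refine ⟨by simpa using h1, fun r hr => h2 r fun i hi => hr ?_, hG.frame hJ (by omega) h2, ?_⟩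
    · rw [regBlock_apply] at hi
      omega
    · refine (hb.mono (by omega)).split_of_disjoint _ fun j hj hj' r t h => ?_
      have hjJ : j ≠ J := by omega
      have hjJ' : j ≠ J + 1 := by omega
      obtain ⟨s, hs⟩ | ⟨s, hs⟩ | ⟨s, hs⟩ := mix_cases h₁ h₂ (tapeBlock_ne (i := J) (j := J + 1)
        (by omega) (by omega) (by omega)) t
      · exact hα j (by omega) hj' s r (hs.symm.trans h.symm)
      · exact tapeBlock_ne hjJ hj' (by omega) r s (h.trans hs)
      · exact tapeBlock_ne hjJ' hj' (by omega) r s (h.trans hs)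

lemma tapesA_ne_tapeBlock (j r t : ℕ) : tapesA r ≠ tapeBlock j t := (tapeBlock_ne_tapesA j t r).symm

/-- Sign `0` with a token, and check the result under the selected public key. -/
lemma exists_sign_verify (A : QPT 1) (B : QPT 0) (k : ℕ) : ∃ C : QPT 1, ∀ n x ψ, ψ ≠ 0 →
    (C.run n x ψ blank).map Prod.fst = (A.run n Data.nil ψ blank).bind fun σ =>
      B.out n (Data.cons (selected k n x) σ.1) := by
  -- Register `16` is kept `nil`, which is both an empty input and the bit `0` to be signed.
  have hA := (spec_call_one A (α := tapesA) (J := 2) le_rfl (by norm_num) 16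
    fun j _ _ => tapesA_ne_tapeBlock j).adapt
    (Pre' := fun (z : Input) G V => ∃ g, z.Init 1 g V ∧ G = (selectInput k).eval g)
    (μ' := fun z => A.run z.n Data.nil z.ψ blank)
    (Post' := fun z σ G V => (G 8 = selected k z.n z.x ∧ G 2 = σ.1) ∧ Clean 4 z.n G ∧ Blank 4 V)
    (by
      rintro z _ V hV ⟨g, hg, rfl⟩
      have hc := clean_selectInput k hg.clean
      refine ⟨((z.n, Data.nil, z.ψ), (selectInput k).eval g, blank), ⟨rfl, hc, hc.nil, by norm_num,
        blank_ne_zero, avoids_blank _, blank_blank _, hg.1.1, hg.mem_one⟩, rfl, ?_⟩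
      rintro σ - g' v - ⟨h1, h2, h3, h4⟩
      refine ⟨⟨?_, h1⟩, h3.mono (by norm_num), h4⟩
      rw [h2 8 (by norm_num), hg.2.1]
      rfl)
  -- The signing call has occupied tape blocks `2` and `3`, so the next free block is `4`.
  have hB := (spec_call_zero B (J := 4) (by norm_num) (by norm_num) 40).adapt
    (Pre' := fun (w : Input × Data × QState) G V => ∃ g, ((g 8 = selected k w.1.n w.1.x ∧
      g 2 = w.2.1) ∧ Clean 4 w.1.n g ∧ Blank 4 V) ∧
      G = (Prog.instr (.cons 40 8 2)).eval g)
    (μ' := fun w => B.run w.1.n (Data.cons (selected k w.1.n w.1.x) w.2.1) blank blank)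
    (Post' := fun w b G V => G 4 = b.1)
    (by
      rintro w _ V hV ⟨g, ⟨⟨h1, h2⟩, h3, h4⟩, rfl⟩
      refine ⟨((w.1.n, Data.cons (selected k w.1.n w.1.x) w.2.1), _, V),
        ⟨rfl, rfl, ⟨?_, ?_, fun r hr => ?_⟩, h4, ?_, by norm_num⟩, rfl, ?_⟩
      · simpa [Prog.eval] using h3.param
      · simpa [Prog.eval] using h3.nil
      · have : r ≠ 40 := by rintro rfl; norm_num at hr
        simpa [Prog.eval, this] using h3.fresh r hr
      · simp [Prog.eval, h1, h2]
      · rintro o - g v - ⟨h1, -⟩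
        exact h1)
  have hB' := hB.map (fun _ b => b.1) (Post' := fun _ y G V => G 4 = y) fun _ _ _ _ h => h
  obtain ⟨C, hC⟩ := (Spec.simple_seq (simple_selectInput k) (hA.seq (Post₂ := fun _ y G V => G 0 = y)
    (Spec.simple_seq (P := .instr (.cons 40 8 2)) trivial
      (Spec.seq_simple (Q := .instr (.copy 0 4)) trivial
        (by simpa [Prog.eval] using hB'))))).exists_qpt Prod.fst
  refine ⟨C, fun n x ψ hψ => ?_⟩
  rw [hC _ _ _ _ (validInput_one hψ)]
  rfl

/-- Sign `1` with a token. -/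
lemma exists_sign_one (A : QPT 1) : ∃ C : QPT 1, ∀ n x ψ, ψ ≠ 0 →
    (C.run n x ψ blank).map Prod.fst =
      (A.run n (Data.ofBool true) ψ blank).map Prod.fst := by
  -- Register `8` receives `cons nil nil`, the bit `1`.
  have hA := (spec_call_one A (α := tapesA) (J := 2) le_rfl (by norm_num) 8
    fun j _ _ => tapesA_ne_tapeBlock j).adapt
    (Pre' := fun (z : Input) G V => ∃ g, z.Init 1 g V ∧
      G = (Prog.instr (.cons 8 16 16)).eval g)
    (μ' := fun z => A.run z.n (Data.ofBool true) z.ψ blank)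
    (Post' := fun z σ G V => G 2 = σ.1)
    (by
      rintro z _ V hV ⟨g, hg, rfl⟩
      have hc := hg.clean
      refine ⟨((z.n, Data.ofBool true, z.ψ), _, blank), ⟨rfl, ⟨?_, ?_, fun r hr => ?_⟩, ?_,
        by norm_num, blank_ne_zero, avoids_blank _, blank_blank _, hg.1.1, hg.mem_one⟩, rfl, ?_⟩
      · simpa [Prog.eval] using hc.param
      · simpa [Prog.eval] using hc.nil
      · have : r ≠ 8 := by rintro rfl; norm_num at hr
        simpa [Prog.eval, this] using hc.fresh r hr
      · simp [Prog.eval, hc.nil, Data.ofBool]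
      · rintro o - g v - ⟨h1, -⟩
        exact h1)
  have hA' := hA.map (fun _ b => b.1) (Post' := fun _ y G V => G 2 = y) fun _ _ _ _ h => h
  obtain ⟨C, hC⟩ := (Spec.simple_seq (P := .instr (.cons 8 16 16)) trivial
      (Spec.seq_simple (Q := .instr (.copy 0 2)) (Post := fun _ y G V => G 0 = y) trivial
        (by simpa [Prog.eval] using hA'))).exists_qpt Prod.fst
  refine ⟨C, fun n x ψ hψ => ?_⟩
  rw [hC _ _ _ _ (validInput_one hψ)]

/-! ## The forger -/

/-- The tapes of the second algorithm of the adversary. -/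
def attackTapes : ℕ ↪ ℕ :=
  mix (tapeBlock 3) tapesA (tapeBlock 4) (tapeBlock_ne_tapesA 3)
    (tapeBlock_ne (by norm_num) (by norm_num) (by norm_num)) (tapesA_ne_tapeBlock 4)

lemma attackTapes_ne {j : ℕ} (hj : 5 ≤ j) (hj' : j < 8) (r t : ℕ) :
    attackTapes r ≠ tapeBlock j t := by
  intro h
  have h3 : 3 ≠ j := by omega
  have h4 : 4 ≠ j := by omega
  obtain ⟨s, hs⟩ | ⟨s, hs⟩ | ⟨s, hs⟩ := mix_cases (tapeBlock_ne_tapesA 3)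
    (tapeBlock_ne (i := 3) (j := 4) (by norm_num) (by norm_num) (by norm_num))
    (tapesA_ne_tapeBlock 4) r
  · exact tapeBlock_ne h3 (by norm_num) hj' s t (hs.symm.trans h)
  · exact tapesA_ne_tapeBlock j s t (hs.symm.trans h)
  · exact tapeBlock_ne h4 (by norm_num) hj' s t (hs.symm.trans h)

/-- Run `P` on the classical input, `A₁` on the result, `A₂` on the outcome together with the
quantum input, and sign `0` with what is left. -/
lemma exists_forger (P A₁ : QPT 0) (A₂ : QPT 2) (A : QPT 1) : ∃ C : QPT 1, ∀ n x ψ, ψ ≠ 0 →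
    (C.run n x ψ blank).map Prod.fst = (P.out n x).bind fun t =>
      (A₁.run n t blank blank).bind fun o => (A₂.run n o.1.snd o.2 ψ).bind fun c =>
        (A.run n Data.nil c.2 blank).map fun σ => Data.cons σ.1 c.1 := by
  -- The quantum residue `w` of `P` is never reset. For each classical outcome it is a tensor factor
  -- on block `2`, which later calls leave alone.
  have hP := (spec_call_zero P le_rfl (by norm_num) 1).adapt
    (Pre' := fun (z : Input) G V => z.Init 1 G V)
    (μ' := fun z => P.run z.n z.x blank blank)
    (Post' := fun z t G V => z.ψ ≠ 0 ∧ G 2 = t.1 ∧ Clean 3 z.n G ∧ Blank 3 V ∧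
      ∃ w, V = split (tapeBlock 2) w (split tapesA z.ψ blank))
    (by
      rintro z G V hV hz
      refine ⟨((z.n, z.x), G, V), ⟨rfl, rfl, hz.clean, ?_, hz.input, by norm_num⟩, rfl, ?_⟩
      · rw [hz.mem_one]
        exact (blank_split_tapesA _).mono (by norm_num)
      · rintro t - g v - ⟨h1, h2, h3, h4, h5⟩
        rw [hz.mem_one] at h5
        exact ⟨hz.1.1, h1, h3, h4, _, h5⟩)
  have hA₁ := (spec_call_zero A₁ (J := 3) (by norm_num) (by norm_num) 2).adapt
    (Pre' := fun (z : Input × Data × QState) G V => z.1.ψ ≠ 0 ∧ G 2 = z.2.1 ∧ Clean 3 z.1.n G ∧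
      Blank 3 V ∧ ∃ w, V = split (tapeBlock 2) w (split tapesA z.1.ψ blank))
    (μ' := fun z => A₁.run z.1.n z.2.1 blank blank)
    (Post' := fun z o G V => z.1.ψ ≠ 0 ∧ G 3 = o.1 ∧ Clean 4 z.1.n G ∧
      ∃ w, V = split (tapeBlock 3) o.2 (split (tapeBlock 2) w (split tapesA z.1.ψ blank)))
    (by
      rintro z G V hV ⟨hψ, h2, hc, hb, w, hw⟩
      refine ⟨((z.1.n, z.2.1), G, V), ⟨rfl, rfl, hc, hb, h2, by norm_num⟩, rfl, ?_⟩
      rintro t - g v - ⟨h1, h2, h3, h4, h5⟩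
      rw [hw] at h5
      exact ⟨hψ, h1, h3, _, h5⟩)
  -- The state from `A₁` already lies on block `3` and the token on the original input tapes, as
  -- `attackTapes` requires.
  have hA₂ := (spec_call A₂ (regBlock 4) attackTapes 8).adapt
    (Pre' := fun (z : (Input × Data × QState) × Data × QState) G V => ∃ g,
      (z.1.1.ψ ≠ 0 ∧ g 3 = z.2.1 ∧ Clean 4 z.1.1.n g ∧
        ∃ w, V = split (tapeBlock 3) z.2.2 (split (tapeBlock 2) w (split tapesA z.1.1.ψ blank))) ∧
      G = (Prog.instr (.snd 8 3)).eval g)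
    (μ' := fun z => A₂.run z.1.1.n z.2.1.snd z.2.2 z.1.1.ψ)
    (Post' := fun z c G V => G 4 = c.1 ∧ Clean 5 z.1.1.n G ∧
      ∃ w, V = split attackTapes c.2 (split (tapeBlock 2) w blank))
    (by
      rintro z _ V hV ⟨g, ⟨hψ, h3, hc, w, rfl⟩, rfl⟩
      obtain ⟨hst, hV'⟩ := ne_zero_of_split_ne_zero hV
      have hw := (ne_zero_of_split_ne_zero hV').1
      have hc' : Clean 4 z.1.1.n ((Prog.instr (.snd 8 3)).eval g) := by
        refine ⟨?_, ?_, fun r hr => ?_⟩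
        · simpa [Prog.eval] using hc.param
        · simpa [Prog.eval] using hc.nil
        · have : r ≠ 8 := by rintro rfl; norm_num at hr
          simpa [Prog.eval, this] using hc.fresh r hr
      have h4 : Avoids (tapeBlock 4) (split (tapeBlock 2) w blank) :=
        avoids_split (avoids_blank _) (tapeBlock_ne (by norm_num) (by norm_num) (by norm_num))
      refine ⟨(⟨z.1.1.n, z.2.1.snd, z.2.2, z.1.1.ψ⟩, _, split (tapeBlock 2) w blank),
        ⟨rfl, ?_⟩, rfl, ?_⟩
      · refine ⟨⟨hst, hψ, fun h => absurd h (by norm_num), fun h => absurd h (by norm_num)⟩,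
          hc'.param, ?_, fun i hi => ?_, fun i => hc'.fresh _ ?_, ?_, ?_, ?_⟩
        · simp [Prog.eval, h3]
        · rw [regBlock_apply] at hi; omega
        · rw [regBlock_apply]; omega
        -- The residue `w` is moved past the token so that the two inputs of `A₂` become adjacent
        -- factors.
        · rw [split_comm (tapeBlock_ne_tapesA 2)]
          exact split_split_eq_split_tensor _ _ _ h4 _ _
        · exact avoids_mix _ _ _
            (avoids_split (avoids_blank _) (tapeBlock_ne (by norm_num) (by norm_num) (by norm_num)))
            (avoids_split (avoids_blank _) (tapesA_ne_tapeBlock 2)) h4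
        · exact split_ne_zero (avoids_blank _) hw blank_ne_zero
      · rintro c - g' v - ⟨h1, h2, h3⟩
        exact ⟨by simpa using h1, hc'.frame (by norm_num) (by norm_num) h2, w, h3⟩)
  have hA := (spec_call_one A (α := attackTapes) (J := 5) (by norm_num) (by norm_num) 16
    fun j hj hj' => attackTapes_ne hj hj').adapt
    (Pre' := fun (z : ((Input × Data × QState) × Data × QState) × Data × QState) G V =>
      G 4 = z.2.1 ∧ Clean 5 z.1.1.1.n G ∧
      ∃ w, V = split attackTapes z.2.2 (split (tapeBlock 2) w blank))
    (μ' := fun z => A.run z.1.1.1.n Data.nil z.2.2 blank)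
    (Post' := fun z σ G V => Data.cons (G 5) (G 4) = Data.cons σ.1 z.2.1)
    (by
      rintro z G V hV ⟨h4, hc, w, rfl⟩
      obtain ⟨hψ, hW⟩ := ne_zero_of_split_ne_zero hV
      refine ⟨((z.1.1.1.n, Data.nil, z.2.2), G, split (tapeBlock 2) w blank),
        ⟨rfl, hc, hc.nil, by norm_num, hW, ?_, ?_, hψ, rfl⟩, rfl, ?_⟩
      · have h2 : ∀ j, 3 ≤ j → j < 8 → Avoids (tapeBlock j) (split (tapeBlock 2) w blank) :=
          fun j hj hj' => avoids_split (avoids_blank _) (tapeBlock_ne (by omega) hj' (by norm_num))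
        exact avoids_mix _ _ _ (h2 3 le_rfl (by norm_num))
          (avoids_split (avoids_blank _) (tapesA_ne_tapeBlock 2)) (h2 4 (by norm_num) (by norm_num))
      · exact (blank_blank 5).split_of_disjoint _ fun j hj hj' =>
          tapeBlock_ne (by omega) hj' (by norm_num)
      · rintro σ - g v - ⟨h1, h2, -⟩
        rw [h1, h2 4 (by norm_num)]
        exact congrArg (Data.cons σ.1) h4)
  have hA' := hA.map (fun z σ => Data.cons σ.1 z.2.1)
    (Post' := fun _ y G V => Data.cons (G 5) (G 4) = y) fun _ _ _ _ h => h
  obtain ⟨C, hC⟩ := (hP.seq (Post₂ := fun _ y G V => G 0 = y) <|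
    hA₁.seq (Post₂ := fun _ y G V => G 0 = y) <|
    Spec.simple_seq (P := .instr (.snd 8 3)) trivial <|
    hA₂.seq (Post₂ := fun _ y G V => G 0 = y) <|
    Spec.seq_simple (Q := .instr (.cons 0 5 4)) trivial
      (by simpa [Prog.eval] using hA')).exists_qpt Prod.fst
  refine ⟨C, fun n x ψ hψ => ?_⟩
  rw [hC _ _ _ _ (validInput_one hψ), QPT.out, PMF.bind_map]
  rfl

/-! ## The experiments -/

/-- Algorithms are constrained only on nonzero inputs, so every state passed on in an experiment
must be known to be nonzero. -/
lemma run_ne_zero {q : ℕ} (A : QPT q) {n : ℕ} {x : Data} {ψ φ : QState} (hψ : ψ ≠ 0)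
    (hφ : φ ≠ 0) : ∀ o ∈ (A.run n x ψ φ).support, o.2 ≠ 0 := by
  intro o ho
  rw [QPT.run, PMF.support_map] at ho
  obtain ⟨c, hc, rfl⟩ := ho
  exact steps_invariant (I := fun c => c.mem ≠ 0) (fun _ h => mem_ne_zero_of_mem_step h)
    (tensor_ne_zero hψ hφ) _ c hc

lemma stateGen_ne_zero (S : TwoTier) (n : ℕ) (sk : Data) :
    ∀ ψ ∈ (S.StateGen n sk).support, ψ ≠ 0 := by
  intro ψ hψ
  rw [TwoTier.StateGen, PMF.support_map] at hψ
  obtain ⟨o, ho, rfl⟩ := hψ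
  exact run_ne_zero _ blank_ne_zero blank_ne_zero o ho

lemma exists_signsWithTokens (S : TwoTier) (k : ℕ) : ∃ R : Revocable, SignsWithTokens R S k := by
  obtain ⟨K, hK⟩ := exists_keyTrees S k
  obtain ⟨G, hG⟩ := exists_select_run S.stateGen k
  obtain ⟨V, hV⟩ := exists_sign_verify S.sign S.ver₀ k
  obtain ⟨D, hD⟩ := exists_sign_one S.sign
  refine ⟨⟨K, G, V, D, S.ver₁⟩, ?_, ?_, ?_, ?_, fun _ _ _ => rfl⟩
  · intro n
    rw [← hK, QPT.out, PMF.map_comp]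
    rfl
  · rintro n sigk l rfl
    simp only [Revocable.Sign, hG, selected_cons, TwoTier.StateGen, PMF.map_comp]
    rfl
  · rintro n vk ψ l hψ rfl
    have h := congrArg (PMF.map Data.accepts) (hV n (Data.cons vk (Data.ofBits l)) ψ hψ)
    rw [PMF.map_comp, PMF.map_bind] at h
    refine h.trans ?_
    simp only [selected_cons, QPT.out, PMF.map_comp]
    have e : (do let σ ← S.Sign n ψ false; S.Ver₀ n (select l vk) σ) =
      (S.Sign n ψ false).bind fun σ => S.Ver₀ n (select l vk) σ := rfl
    rw [e, TwoTier.Sign, PMF.bind_map]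
    rfl
  · intro n ψ hψ
    exact hD n Data.nil ψ hψ

/-! ### Distribution of the key trees and of the guessed position. -/

lemma keyTrees_map_select (S : TwoTier) (n : ℕ) (l : List Bool) :
    (keyTrees S n l.length).map (fun T => (select l T.1, select l T.2)) = S.KeyGen n := by
  induction l with
  | nil => exact PMF.map_id _
  | cons b l ih =>
    have e : keyTrees S n (b :: l).length = (keyTrees S n l.length).bind fun a =>
      (keyTrees S n l.length).bind fun b => PMF.pure (Data.cons a.1 b.1, Data.cons a.2 b.2) := rfl
    rw [e, ← ih]
    simp only [PMF.map_bind, PMF.pure_map, select, Data.fst, Data.snd]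
    cases b
    · simp only [Bool.false_eq_true, if_false, PMF.bind_const]
      rfl
    · simp only [if_true]
      rw [PMF.bind_const]
      rfl

/-- A uniformly random bit string of length `k`. -/
def randBits : ℕ → PMF (List Bool)
  | 0 => PMF.pure []
  | k + 1 => (randBits k).bind fun l => coin.map fun b => b :: l

/-- The planted position is hidden perfectly. By induction, the subtree with the planted key looks
honest and its sibling is honest; since two such subtrees are independent and identically
distributed, the coin that orders them is independent of the resulting tree. -/
lemma keyGen_bind_plant (S : TwoTier) (n k : ℕ) {β : Type}
    (f : Data → Data → List Bool → Data → PMF β) :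
    ((S.KeyGen n).bind fun p => (plant S n p.2 k).bind fun a => f p.1 p.2 a.1 a.2) =
      (randBits k).bind fun l => (keyTrees S n k).bind fun T =>
        f (select l T.1) (select l T.2) l T.2 := by
  induction k generalizing f with
  | zero => simp only [plant, randBits, PMF.pure_bind, keyTrees, select]
  | succ k ih =>
    have e : keyTrees S n (k + 1) = (keyTrees S n k).bind fun a =>
      (keyTrees S n k).bind fun b => PMF.pure (Data.cons a.1 b.1, Data.cons a.2 b.2) := rfl
    have := ih fun sk pk l t => (keyTrees S n k).bind fun b => coin.bind fun c =>
      f sk pk (c :: l) (if c then Data.cons b.2 t else Data.cons t b.2)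
    simp only [plant, randBits, e, PMF.bind_bind, PMF.bind_map, PMF.pure_bind, Function.comp_def]
    rw [this]
    congr 1
    funext l
    have hswap : ∀ g : Data × Data → Data × Data → Bool → PMF β,
        ((keyTrees S n k).bind fun a => (keyTrees S n k).bind fun b => coin.bind fun c => g a b c) =
        coin.bind fun c => (keyTrees S n k).bind fun a => (keyTrees S n k).bind fun b => g a b c := by
      intro g
      rw [PMF.bind_comm coin]
      congr 1
      funext a
      rw [PMF.bind_comm coin]
    rw [hswap]
    congr 1
    funext c
    cases c
    · rfl
    -- When the bit is `1`, the two subtrees are exchanged, which does not change their joint law.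
    · rw [PMF.bind_comm]
      rfl

/-- The term of the tail of `l` alone suffices. Only this lower bound on the probability of a
correct guess is needed. -/
lemma le_randBits (l : List Bool) : (2⁻¹ : ℝ≥0∞) ^ l.length ≤ randBits l.length l := by
  induction l with
  | nil => simp [randBits]
  | cons b l ih =>
    have h : (coin.map fun c => c :: l) (b :: l) = 2⁻¹ := by
      rw [PMF.map_apply, tsum_eq_single b]
      · simp [coin]
      · intro c hc
        rw [if_neg]
        simpa using hc.symm
    rw [List.length_cons, pow_succ, randBits, PMF.bind_apply]
    refine le_trans ?_ (ENNReal.le_tsum l)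
    rw [h]
    gcongr

lemma mul_bind_le {α β : Type} {c : ℝ≥0∞} (p : PMF α) {f g : α → PMF β} {b : β}
    (h : ∀ a ∈ p.support, c * f a b ≤ g a b) : c * p.bind f b ≤ p.bind g b := by
  rw [PMF.bind_apply, PMF.bind_apply, ← ENNReal.tsum_mul_left]
  refine ENNReal.tsum_le_tsum fun a => ?_
  by_cases ha : p a = 0
  · simp [ha]
  · rw [mul_left_comm]
    gcongr
    exact h a ((PMF.mem_support_iff _ _).2 ha)

namespace SignsWithTokens

variable {R : Revocable} {S : TwoTier} {k : ℕ}

lemma correctGame_eq (h : SignsWithTokens R S k) (n : ℕ) {l : List Bool} (hl : l.length = k) :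
    R.correctGame n (Data.ofBits l) = S.correctGame₀ n := by
  have e : R.correctGame n (Data.ofBits l) = (R.KeyGen n).bind fun T =>
    (R.Sign n T.1 (Data.ofBits l)).bind fun p => R.Ver n T.2 p.1 (Data.ofBits l) := rfl
  have e' : S.correctGame₀ n = (S.KeyGen n).bind fun p => (S.StateGen n p.1).bind fun ψ =>
    (S.Sign n ψ false).bind fun σ => S.Ver₀ n p.2 σ := rfl
  rw [e, e', h.keyGen, ← keyTrees_map_select S n l, hl, PMF.bind_map]
  congr 1
  funext T
  rw [h.sign n _ l hl, PMF.bind_map]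
  exact bind_congr_of_support fun ψ hψ => h.ver n _ ψ l (stateGen_ne_zero S n _ ψ hψ) hl

lemma deletionGame_eq (h : SignsWithTokens R S k) (n : ℕ) {l : List Bool} (hl : l.length = k) :
    R.deletionGame n (Data.ofBits l) = S.correctGame₁ n := by
  have e : R.deletionGame n (Data.ofBits l) = (R.KeyGen n).bind fun T =>
    (R.Sign n T.1 (Data.ofBits l)).bind fun p => (R.Del n p.1).bind fun c => R.Cert n p.2 c := rfl
  have e' : S.correctGame₁ n = (S.KeyGen n).bind fun p => (S.StateGen n p.1).bind fun ψ =>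
    (S.Sign n ψ true).bind fun σ => S.Ver₁ n p.1 σ := rfl
  rw [e, e', h.keyGen, ← keyTrees_map_select S n l, hl, PMF.bind_map]
  congr 1
  funext T
  rw [h.sign n _ l hl, PMF.bind_map]
  refine bind_congr_of_support fun ψ hψ => ?_
  simp only [Function.comp_apply, h.del n ψ (stateGen_ne_zero S n _ ψ hψ), h.cert]

/-- The end of the forgery experiment, for the key pair at position `l`, after the first algorithm
of the adversary has output `o`. -/
def attack (S : TwoTier) (n : ℕ) (A₂ : QPT 2) (o : Data × QState) (sk pk : Data) : PMF Bool :=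
  (S.StateGen n sk).bind fun ψ => (A₂.run n o.1.snd o.2 ψ).bind fun c =>
    (S.Sign n c.2 false).bind fun σ => (S.Ver₀ n pk σ).bind fun b₀ =>
      (S.Ver₁ n sk c.1).bind fun b₁ => PMF.pure (b₀ && b₁)

/-- The forgery experiment is rewritten so that the guess `l` is drawn last, after `A₁` has
committed to its message. -/
lemma exists_forgeGame_eq (S : TwoTier) (k : ℕ) (A : Revocable.Adversary) : ∃ B : QPT 1, ∀ n,
    S.forgeGame n B = (keyTrees S n k).bind fun T => (A.fst.run n T.2 blank blank).bind fun o =>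
      (randBits k).bind fun l => attack S n A.snd o (select l T.1) (select l T.2) := by
  obtain ⟨P, hP⟩ := exists_plant S k
  obtain ⟨B, hB⟩ := exists_forger P A.fst A.snd S.sign
  refine ⟨B, fun n => ?_⟩
  have e : S.forgeGame n B = (S.KeyGen n).bind fun p => (S.StateGen n p.1).bind fun ψ =>
    ((B.run n p.2 ψ blank).map Prod.fst).bind fun σ => (S.Ver₀ n p.2 σ.fst).bind fun b₀ =>
      (S.Ver₁ n p.1 σ.snd).bind fun b₁ => PMF.pure (b₀ && b₁) := by
    simp only [PMF.bind_map]
    rfl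
  have e' : S.forgeGame n B = (S.KeyGen n).bind fun p => (plant S n p.2 k).bind fun a =>
      (A.fst.run n a.2 blank blank).bind fun o => attack S n A.snd o p.1 p.2 := by
    rw [e]
    congr 1
    funext p
    have : ∀ ψ ∈ (S.StateGen n p.1).support,
        (((B.run n p.2 ψ blank).map Prod.fst).bind fun σ => (S.Ver₀ n p.2 σ.fst).bind fun b₀ =>
          (S.Ver₁ n p.1 σ.snd).bind fun b₁ => PMF.pure (b₀ && b₁)) =
        (plant S n p.2 k).bind fun a => (A.fst.run n a.2 blank blank).bind fun o =>
          (A.snd.run n o.1.snd o.2 ψ).bind fun c =>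
            (S.Sign n c.2 false).bind fun σ => (S.Ver₀ n p.2 σ).bind fun b₀ =>
              (S.Ver₁ n p.1 c.1).bind fun b₁ => PMF.pure (b₀ && b₁) := by
      intro ψ hψ
      rw [hB n _ ψ (stateGen_ne_zero S n _ ψ hψ), hP]
      simp only [PMF.bind_bind, PMF.bind_map, Function.comp_def, Data.fst, Data.snd, TwoTier.Sign,
        Data.ofBool]
    -- Given the key pair, the token is independent of the planting and of the run of `A₁`, so it
    -- may be drawn after both, as in the deletion experiment.
    rw [bind_congr_of_support this, PMF.bind_comm]
    congr 1
    funext a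
    rw [PMF.bind_comm]
    rfl
  rw [e', keyGen_bind_plant S n k fun sk pk l t =>
    (A.fst.run n t blank blank).bind fun o => attack S n A.snd o sk pk, PMF.bind_comm]
  congr 1
  funext T
  rw [PMF.bind_comm]

lemma mul_revokeGame_le (h : SignsWithTokens R S k) (A : Revocable.Adversary) : ∃ B : QPT 1,
    ∀ n, (2⁻¹ : ℝ≥0∞) ^ k * R.revokeGame n k A true ≤ S.forgeGame n B true := by
  obtain ⟨B, hB⟩ := exists_forgeGame_eq S k A
  refine ⟨B, fun n => ?_⟩
  classical
  have e : R.revokeGame n k A = (R.KeyGen n).bind fun T =>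
      (A.fst.run n T.2 blank blank).bind fun o => (R.Sign n T.1 o.1.fst).bind fun p =>
        (A.snd.run n o.1.snd o.2 p.1).bind fun c => (R.Cert n p.2 c.1).bind fun b =>
          (R.Ver n T.2 c.2 o.1.fst).bind fun b' => PMF.pure
            (decide (∃ l : List Bool, l.length = k ∧ o.1.fst = Data.ofBits l) && (b && b')) := by
    unfold Revocable.revokeGame
    congr!
  rw [e, hB, h.keyGen]
  -- Both experiments begin with the key tree and `A₁`, so the bound may be proved for each fixed
  -- outcome of these.
  refine mul_bind_le _ fun T _ => mul_bind_le _ fun o ho => ?_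
  have ho' : o.2 ≠ 0 := run_ne_zero _ blank_ne_zero blank_ne_zero o ho
  by_cases hm : ∃ l : List Bool, l.length = k ∧ o.1.fst = Data.ofBits l
  · obtain ⟨l, hl, hm'⟩ := id hm
    have hR : ((R.Sign n T.1 o.1.fst).bind fun p =>
        (A.snd.run n o.1.snd o.2 p.1).bind fun c => (R.Cert n p.2 c.1).bind fun b =>
          (R.Ver n T.2 c.2 o.1.fst).bind fun b' => PMF.pure
            (decide (∃ l : List Bool, l.length = k ∧ o.1.fst = Data.ofBits l) && (b && b'))) =
        attack S n A.snd o (select l T.1) (select l T.2) := by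
      simp only [hm, decide_true, Bool.true_and]
      rw [hm', h.sign n _ l hl, PMF.bind_map, attack]
      refine bind_congr_of_support fun ψ hψ => ?_
      refine bind_congr_of_support fun c hc => ?_
      have hc' : c.2 ≠ 0 := run_ne_zero _ ho' (stateGen_ne_zero S n _ ψ hψ) c hc
      have e₂ : R.Ver n T.2 c.2 (Data.ofBits l) = (S.Sign n c.2 false).bind fun σ =>
        S.Ver₀ n (select l T.2) σ := h.ver n _ _ l hc' hl
      -- The two verifications are independent given `c`, so their order may be exchanged.
      rw [e₂, h.cert, PMF.bind_comm, PMF.bind_bind]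
      congr 1
      funext σ
      congr 1
      funext b₀
      congr 1
      funext b₁
      rw [Bool.and_comm]
    -- Of all guesses only the correct one is kept; the other terms are nonnegative.
    rw [hR, PMF.bind_apply]
    refine le_trans ?_ (ENNReal.le_tsum l)
    gcongr
    exact hl ▸ le_randBits l
  -- With a message outside `{0,1}^k` the adversary loses for certain, so the left side is zero.
  · have hR : ∀ p : QState × Data, ((A.snd.run n o.1.snd o.2 p.1).bind fun c =>
        (R.Cert n p.2 c.1).bind fun b => (R.Ver n T.2 c.2 o.1.fst).bind fun b' => PMF.pure
          (decide (∃ l : List Bool, l.length = k ∧ o.1.fst = Data.ofBits l) && (b && b'))) =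
        PMF.pure false := by
      intro p
      simp only [hm, decide_false, Bool.false_and, PMF.bind_const]
    simp only [hR, PMF.bind_const]
    simp

lemma mul_prob_revokeGame_le (h : SignsWithTokens R S k) (A : Revocable.Adversary) : ∃ B : QPT 1,
    ∀ n, (1 / 2 ^ k : ℝ) * prob (R.revokeGame n k A) ≤ prob (S.forgeGame n B) := by
  obtain ⟨B, hB⟩ := h.mul_revokeGame_le A
  refine ⟨B, fun n => ?_⟩
  have := ENNReal.toReal_mono (PMF.apply_ne_top _ _) (hB n)
  rw [ENNReal.toReal_mul] at this
  simpa [prob] using this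

lemma noQueryDeletionSecure (h : SignsWithTokens R S k) (hS : S.Secure) :
    R.NoQueryDeletionSecure k := by
  intro A
  obtain ⟨B, hB⟩ := h.mul_prob_revokeGame_le A
  refine ((hS B).const_mul (2 ^ k)).trans_abs_le fun n => ?_
  have h0 : 0 ≤ prob (R.revokeGame n k A) := ENNReal.toReal_nonneg
  have h1 : 0 ≤ prob (S.forgeGame n B) := ENNReal.toReal_nonneg
  rw [abs_of_nonneg h0, abs_of_nonneg (by positivity)]
  have := hB n
  rw [one_div, inv_mul_le_iff₀ (by positivity)] at this
  exact this

end SignsWithTokens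

end QCrypto

end

theorem mainTheorem8 (S : QCrypto.TwoTier) (hcorrect : S.Correct) (hsecure : S.Secure) (k : ℕ) :
    ∃ R : QCrypto.Revocable,
      QCrypto.SignsWithTokens R S k ∧
      R.Correct k ∧ R.DeletionCorrect k ∧ R.NoQueryDeletionSecure k ∧
      ∀ A : QCrypto.Revocable.Adversary, ∃ B : QCrypto.QPT 1, ∀ n : ℕ,
        (1 / 2 ^ k : ℝ) * QCrypto.prob (R.revokeGame n k A) ≤ QCrypto.prob (S.forgeGame n B) := by
  obtain ⟨R, h⟩ := QCrypto.exists_signsWithTokens S k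
  refine ⟨R, h, fun l hl => ?_, fun l hl => ?_, h.noQueryDeletionSecure hsecure,
    h.mul_prob_revokeGame_le⟩
  · simpa only [h.correctGame_eq _ hl] using hcorrect.1
  · simpa only [h.deletionGame_eq _ hl] using hcorrect.2
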